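/- Let $\mathbb{N}^{\mathbb{N}}$ be Baire space. A represented space is a set $X$ with a partial surjection $\delta_X:\subseteq\mathbb{N}^{\mathbb{N}}\to X$; if $\delta_X(p)=x$, then $p$ is a name of $x$. A problem $f:\subseteq X\rightrightarrows Y$ between represented spaces is a partial multi-valued function. For problems $f:\subseteq X\rightrightarrows Y$ and $g:\subseteq Z\rightrightarrows W$, $f\le_{\mathrm W} g$ means that there are computable partial functions $\Phi,\Psi:\subseteq\mathbb{N}^{\mathbb{N}}\to\mathbb{N}^{\mathbb{N}}$ (in the sense of type-2 computability) such that, whenever $p$ is a name of some $x\in\operatorname{dom}(f)$, $\Phi(p)$ is defined and is a name of some $z\in\operatorname{dom}(g)$, and for every name $q$ of an element of $g(z)$, $\Psi(p*q)$ is defined and is a name of an element of $f(x)$, where $p*q=p(0)q(0)p(1)q(1)\cdots$. We write $f\equiv_{\mathrm W}g$ if $f\le_{\mathrm W}g$ and $g\le_{\mathrm W}f$. A computable Polish space $\mathcal{X}=(X,d,\alpha)$ is a complete metric space $(X,d)$ with a dense sequence $\alpha:\mathbb{N}\to X$ such that $(n,m)\mapsto d(\alpha(n),\alpha(m))$ is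 a computable double sequence of reals. Let $(q_m)_{m\in\mathbb{N}}$ be a computable enumeration of $\mathbb{Q}$ and let $B_{\langle n,m\rangle}$ be the open ball with centre $\alpha(n)$ and radius $q_m$ (empty if $q_m\le 0$). Let $\mathcal{A}_-(\mathcal{X})$ be the space of closed subsets of $X$ in the negative representation, in which $p\in\mathbb{N}^{\mathbb{N}}$ is a name of $X\setminus\bigcup_{i}B_{p(i)}$. The problem $\mathsf{PST}_{\mathcal{X}}:\subseteq\mathcal{A}_-(\mathcal{X})\rightrightarrows\mathcal{A}_-(\mathcal{X})$ has as domain the uncountable closed sets $A\subseteq X$, and its solutions for $A$ are the nonempty perfect sets $P\subseteq A$ (closed, nonempty, without isolated points). Theorem. Regard $[0,1]$ (with the Euclidean metric and a standard enumeration of its rational points) and $\mathbb{N}^{\mathbb{N}}$ (with the metric $d(x,y)=2^{-\min\{n:x(n)\ne y(n)\}}$ for $x\neq y$, and a standard enumeration of the eventually zero sequences) as computable Polish spaces. Then $$\mathsf{PST}_{[0,1]}\equiv_{\mathrm W}\mathsf{PST}_{\mathbb{N}^{\mathbb{N}}}.$$ -/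

import Mathlib

open Set Filter Topology

/-! ### Computable partial functions on Baire space -/

/-- The initial segment `p(0), …, p(n-1)` of `p`. -/
def initSeg (p : ℕ → ℕ) (n : ℕ) : List ℕ := (List.range n).map p

/-- A partial function on Baire space is computable (in the sense of type-2 computability) if it is
the partial function induced by a computable prefix-monotone map `f` on finite words: the value at
`p` is the infinite sequence approximated by the words `f (p[m])`, and `p` is in the domain exactly
if these words grow beyond every length. -/
def Type2Computable (F : (ℕ → ℕ) →. (ℕ → ℕ)) : Prop :=
  ∃ f : List ℕ → List ℕ, Computable f ∧
    (∀ σ τ : List ℕ, σ <+: τ → f σ <+: f τ) ∧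
    ∀ p q : ℕ → ℕ, q ∈ F p ↔ ∀ n, ∃ m, initSeg q n <+: f (initSeg p m)

/-- The interleaving `p * q = p(0), q(0), p(1), q(1), …`. -/
def interleave (p q : ℕ → ℕ) : ℕ → ℕ := fun n => if n % 2 = 0 then p (n / 2) else q (n / 2)

/-! ### Represented spaces, problems, and Weihrauch reducibility -/

/-- A represented space: a set with a partial surjection from Baire space onto it. -/
structure RepresentedSpace where
  carrier : Type
  rep : (ℕ → ℕ) →. carrier
  surjective : ∀ x : carrier, ∃ p : ℕ → ℕ, x ∈ rep p

/-- A computational problem, that is a partial multi-valued function between represented spaces. -/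
structure Problem (X Y : RepresentedSpace) where
  dom : Set X.carrier
  sol : X.carrier → Set Y.carrier
  sol_nonempty : ∀ x ∈ dom, (sol x).Nonempty

/-- Weihrauch reducibility. Here `x ∈ X.rep p` says that `p` is a name of `x`. -/
def WeihrauchLE {X Y Z W : RepresentedSpace} (f : Problem X Y) (g : Problem Z W) : Prop :=
  ∃ Φ Ψ : (ℕ → ℕ) →. (ℕ → ℕ), Type2Computable Φ ∧ Type2Computable Ψ ∧
    ∀ (p : ℕ → ℕ) (x : X.carrier), x ∈ X.rep p → x ∈ f.dom →
      ∃ p' ∈ Φ p, ∃ y ∈ Z.rep p', y ∈ g.dom ∧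
        ∀ (q : ℕ → ℕ) (z : W.carrier), z ∈ W.rep q → z ∈ g.sol y →
          ∃ r ∈ Ψ (interleave p q), ∃ w ∈ Y.rep r, w ∈ f.sol x

/-- Weihrauch equivalence. -/
def WeihrauchEquiv {X Y Z W : RepresentedSpace} (f : Problem X Y) (g : Problem Z W) : Prop :=
  WeihrauchLE f g ∧ WeihrauchLE g f

/-! ### Computable Polish spaces -/

/-- A computable enumeration of the rational numbers: `⟨⟨a, b⟩, c⟩ ↦ (a - b) / (c + 1)`. -/
def ratEnum (n : ℕ) : ℚ :=
  (((Nat.unpair (Nat.unpair n).1).1 : ℚ) - ((Nat.unpair (Nat.unpair n).1).2 : ℚ)) /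
    (((Nat.unpair n).2 : ℚ) + 1)

theorem ratEnum_pair (a b c : ℕ) :
    ratEnum (Nat.pair (Nat.pair a b) c) = ((a : ℚ) - (b : ℚ)) / ((c : ℚ) + 1) := by
  simp [ratEnum]

theorem ratEnum_surjective : Function.Surjective ratEnum := by
  intro r
  refine ⟨Nat.pair (Nat.pair r.num.toNat (-r.num).toNat) (r.den - 1), ?_⟩
  rw [ratEnum_pair]
  have h1 : ((r.num.toNat : ℚ) - ((-r.num).toNat : ℚ)) = (r.num : ℚ) := by
    have h : ((r.num.toNat : ℤ) - ((-r.num).toNat : ℤ)) = r.num := by omega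
    exact_mod_cast h
  have h2 : (((r.den - 1 : ℕ) : ℚ) + 1) = (r.den : ℚ) := by
    have h : r.den - 1 + 1 = r.den := Nat.succ_pred_eq_of_pos r.den_pos
    exact_mod_cast h
  rw [h1, h2, Rat.num_div_den]

/-- `p` is a name of the real number `x` in the Cauchy representation. -/
def IsRealName (p : ℕ → ℕ) (x : ℝ) : Prop :=
  (∀ j i : ℕ, j < i → |(ratEnum (p i) : ℝ) - (ratEnum (p j) : ℝ)| < (2 : ℝ)⁻¹ ^ j) ∧
    Tendsto (fun n => (ratEnum (p n) : ℝ)) atTop (𝓝 x)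

/-- A computable Polish space: a complete metric space with a dense sequence such that the
distances between members of the sequence form a computable double sequence of real numbers. -/
structure ComputablePolishSpace where
  carrier : Type
  metric : MetricSpace carrier
  complete : CompleteSpace carrier
  seq : ℕ → carrier
  dense : DenseRange seq
  computable_dist : ∃ f : ℕ × ℕ × ℕ → ℕ, Computable f ∧
    ∀ n m : ℕ, IsRealName (fun k => f (n, m, k)) (dist (seq n) (seq m))

attribute [instance] ComputablePolishSpace.metric ComputablePolishSpace.complete

/-- The basic open ball `B_⟨n,m⟩`, with centre the `n`-th point of the dense sequence and radius
the `m`-th rational number (so it is empty if that number is not positive). -/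
def ComputablePolishSpace.basicBall (X : ComputablePolishSpace) (i : ℕ) : Set X.carrier :=
  Metric.ball (X.seq (Nat.unpair i).1) (ratEnum (Nat.unpair i).2 : ℝ)

/-- The closed set with negative information `p`: the complement of the union of the `B_{p(i)}`. -/
def ComputablePolishSpace.closedOfName (X : ComputablePolishSpace) (p : ℕ → ℕ) :
    TopologicalSpace.Closeds X.carrier :=
  ⟨(⋃ i, X.basicBall (p i))ᶜ,
    (isOpen_iUnion fun _ => Metric.isOpen_ball).isClosed_compl⟩

theorem ComputablePolishSpace.closedOfName_surjective (X : ComputablePolishSpace) :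
    Function.Surjective X.closedOfName := by
  intro A
  have hne : {i : ℕ | X.basicBall i ⊆ (A : Set X.carrier)ᶜ}.Nonempty := by
    refine ⟨Nat.pair 0 0, ?_⟩
    simp [basicBall, ratEnum]
  obtain ⟨p, hp⟩ := (Set.to_countable {i : ℕ | X.basicBall i ⊆ (A : Set X.carrier)ᶜ}).exists_eq_range hne
  refine ⟨p, ?_⟩
  apply TopologicalSpace.Closeds.ext
  change (⋃ i, X.basicBall (p i))ᶜ = (A : Set X.carrier)
  rw [compl_eq_comm]
  apply Set.Subset.antisymm
  · intro x hx
    obtain ⟨ε, hε, hball⟩ := Metric.isOpen_iff.1 A.isClosed.isOpen_compl x hx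
    obtain ⟨n, hn⟩ := X.dense.exists_dist_lt x (half_pos hε)
    obtain ⟨r, hr1, hr2⟩ := exists_rat_btwn hn
    obtain ⟨m, rfl⟩ := ratEnum_surjective r
    have hmem : Nat.pair n m ∈ {i : ℕ | X.basicBall i ⊆ (A : Set X.carrier)ᶜ} := by
      intro y hy
      apply hball
      simp only [basicBall, Nat.unpair_pair, Metric.mem_ball] at hy ⊢
      have := dist_triangle_right y x (X.seq n)
      linarith
    rw [hp] at hmem
    obtain ⟨k, hk⟩ := hmem
    refine Set.mem_iUnion.2 ⟨k, ?_⟩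
    rw [hk]
    simpa [basicBall] using hr1
  · refine Set.iUnion_subset fun k => ?_
    have : p k ∈ {i : ℕ | X.basicBall i ⊆ (A : Set X.carrier)ᶜ} := hp ▸ Set.mem_range_self k
    exact this

/-- The represented space of closed subsets of `X` with the negative representation. -/
def negClosed (X : ComputablePolishSpace) : RepresentedSpace where
  carrier := TopologicalSpace.Closeds X.carrier
  rep := fun p => Part.some (X.closedOfName p)
  surjective := fun A => by
    obtain ⟨p, hp⟩ := X.closedOfName_surjective A
    exact ⟨p, by simp [hp]⟩

/-- The perfect set problem: given an uncountable closed set, find a nonempty perfect subset. -/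
def PST (X : ComputablePolishSpace) : Problem (negClosed X) (negClosed X) where
  dom := {A : TopologicalSpace.Closeds X.carrier | ¬ (A : Set X.carrier).Countable}
  sol := fun A : TopologicalSpace.Closeds X.carrier =>
    {P : TopologicalSpace.Closeds X.carrier |
      (P : Set X.carrier) ⊆ (A : Set X.carrier) ∧
        Perfect (P : Set X.carrier) ∧ (P : Set X.carrier).Nonempty}
  sol_nonempty := by
    intro (A : TopologicalSpace.Closeds X.carrier) hA
    have : TopologicalSpace.SeparableSpace X.carrier :=
      ⟨⟨Set.range X.seq, Set.countable_range _, X.dense⟩⟩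
    have : SecondCountableTopology X.carrier := UniformSpace.secondCountable_of_separable _
    obtain ⟨D, hD, hne, hsub⟩ :=
      exists_perfect_nonempty_of_isClosed_of_not_countable A.isClosed hA
    exact ⟨(⟨D, hD.closed⟩ : TopologicalSpace.Closeds X.carrier), hsub, hD, hne⟩

/-! ### Baire space and the unit interval as computable Polish spaces -/

theorem isRealName_const {c : ℕ} {x : ℝ} (h : (ratEnum c : ℝ) = x) :
    IsRealName (fun _ => c) x := by
  refine ⟨fun j i _ => ?_, ?_⟩
  · simp
  · simp [h]

/-- The dense sequence of Baire space: finite sequences extended by zeros. -/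
def baireSeq (n : ℕ) : ℕ → ℕ := fun i => (Denumerable.ofNat (List ℕ) n).getD i 0

/-- An index, in the enumeration of the rationals, of the distance of two members of `baireSeq`. -/
def baireDistIndex (n m : ℕ) : ℕ :=
  let l := Denumerable.ofNat (List ℕ) n
  let l' := Denumerable.ofNat (List ℕ) m
  let N := l.length + l'.length
  let k := (List.range N).findIdx fun i => !decide (l.getD i 0 = l'.getD i 0)
  if k = N then 0 else Nat.pair (Nat.pair 1 0) (2 ^ k - 1)

theorem primrec_baireDistIndex : Primrec₂ baireDistIndex := by
  have hl : Primrec fun t : ℕ × ℕ => Denumerable.ofNat (List ℕ) t.1 :=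
    (Primrec.ofNat _).comp Primrec.fst
  have hl' : Primrec fun t : ℕ × ℕ => Denumerable.ofNat (List ℕ) t.2 :=
    (Primrec.ofNat _).comp Primrec.snd
  have hN : Primrec fun t : ℕ × ℕ => (Denumerable.ofNat (List ℕ) t.1).length +
      (Denumerable.ofNat (List ℕ) t.2).length :=
    Primrec.nat_add.comp (Primrec.list_length.comp hl) (Primrec.list_length.comp hl')
  have hk : Primrec fun t : ℕ × ℕ => (List.range ((Denumerable.ofNat (List ℕ) t.1).length +
      (Denumerable.ofNat (List ℕ) t.2).length)).findIdx fun i =>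
        !decide ((Denumerable.ofNat (List ℕ) t.1).getD i 0 =
          (Denumerable.ofNat (List ℕ) t.2).getD i 0) := by
    refine Primrec.list_findIdx (Primrec.list_range.comp hN) ?_
    refine Primrec.not.comp ?_
    exact (Primrec.eq (α := ℕ)).decide.comp
      ((Primrec.list_getD 0).comp (hl.comp Primrec.fst) Primrec.snd)
      ((Primrec.list_getD 0).comp (hl'.comp Primrec.fst) Primrec.snd)
  have hpow : Primrec fun k : ℕ => 2 ^ k := by
    have : Primrec fun k : ℕ => Nat.rec (motive := fun _ => ℕ) 1 (fun _ r => r * 2) k :=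
      Primrec.nat_rec₁ 1 (Primrec.nat_mul.comp Primrec.snd (Primrec.const 2))
    refine this.of_eq fun k => ?_
    induction k with
    | zero => rfl
    | succ k ih => rw [pow_succ, ← ih]
  refine Primrec.ite (Primrec.eq.comp hk hN) (Primrec.const 0) ?_
  exact Primrec₂.natPair.comp (Primrec.const _)
    (Primrec.nat_sub.comp (hpow.comp hk) (Primrec.const 1))

theorem ratEnum_baireDistIndex (n m : ℕ) :
    (ratEnum (baireDistIndex n m) : ℝ) =
      @dist (ℕ → ℕ) PiNat.metricSpaceNatNat.toDist (baireSeq n) (baireSeq m) := by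
  change _ = @dist (ℕ → ℕ) PiNat.dist (baireSeq n) (baireSeq m)
  unfold baireDistIndex
  set l := Denumerable.ofNat (List ℕ) n with hl
  set l' := Denumerable.ofNat (List ℕ) m with hl'
  set N := l.length + l'.length with hN
  set k := (List.range N).findIdx fun i => !decide (l.getD i 0 = l'.getD i 0) with hk
  have hlen : (List.range N).length = N := List.length_range
  dsimp only
  split_ifs with h
  · have heq : baireSeq n = baireSeq m := by
      funext i
      change l.getD i 0 = l'.getD i 0
      by_cases hi : i < N
      · have hall := List.findIdx_eq_length.1 (h.trans hlen.symm) i (List.mem_range.2 hi)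
        simpa using hall
      · rw [List.getD_eq_default _ _ (by omega), List.getD_eq_default _ _ (by omega)]
    rw [heq, PiNat.dist_self]
    simp [ratEnum]
  · have hlt : k < (List.range N).length := by
      have : k ≤ (List.range N).length := List.findIdx_le_length
      rw [hlen] at this ⊢
      exact lt_of_le_of_ne this h
    have hne : baireSeq n k ≠ baireSeq m k := by
      have hget := List.findIdx_getElem (w := hlt)
      rw [List.getElem_range, ← hk] at hget
      intro e
      change l.getD k 0 = l'.getD k 0 at e
      rw [e] at hget
      simp at hget
    have hbelow : ∀ i < k, baireSeq n i = baireSeq m i := by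
      intro i hi
      have hget := List.not_of_lt_findIdx hi
      rw [List.getElem_range] at hget
      change l.getD i 0 = l'.getD i 0
      simpa using hget
    have hne' : baireSeq n ≠ baireSeq m := fun e => hne (congrFun e k)
    have hfd : PiNat.firstDiff (baireSeq n) (baireSeq m) = k := by
      apply le_antisymm
      · by_contra hcon
        exact hne (PiNat.apply_eq_of_lt_firstDiff (not_le.1 hcon))
      · by_contra hcon
        exact PiNat.apply_firstDiff_ne hne' (hbelow _ (not_le.1 hcon))
    rw [PiNat.dist_eq_of_ne hne', hfd, ratEnum_pair]
    have h2 : ((2 ^ k - 1 : ℕ) : ℝ) + 1 = 2 ^ k := by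
      have : 2 ^ k - 1 + 1 = 2 ^ k := Nat.succ_pred_eq_of_pos (Nat.two_pow_pos k)
      exact_mod_cast this
    push_cast
    rw [h2]
    simp

theorem baire_computable_dist : ∃ f : ℕ × ℕ × ℕ → ℕ, Computable f ∧
    ∀ n m : ℕ, IsRealName (fun k => f (n, m, k))
      (@dist (ℕ → ℕ) PiNat.metricSpaceNatNat.toDist (baireSeq n) (baireSeq m)) := by
  have h : Primrec fun t : ℕ × ℕ × ℕ => baireDistIndex t.1 t.2.1 :=
    primrec_baireDistIndex.comp Primrec.fst (Primrec.fst.comp Primrec.snd)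
  exact ⟨_, h.to_comp, fun n m => isRealName_const (c := baireDistIndex n m)
    (ratEnum_baireDistIndex n m)⟩

/-- Baire space `ℕ^ℕ` with the metric `d(x, y) = 2^{-min {n | x n ≠ y n}}`. -/
noncomputable def baireSpace : ComputablePolishSpace where
  carrier := ℕ → ℕ
  metric := PiNat.metricSpaceNatNat
  complete := inferInstanceAs (CompleteSpace (ℕ → ℕ))
  seq := baireSeq
  dense := by
    intro x
    rw [(PiNat.isTopologicalBasis_cylinders fun _ : ℕ => ℕ).mem_closure_iff]
    rintro _ ⟨y, k, rfl⟩ hx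
    refine ⟨baireSeq (Encodable.encode (initSeg x k)), ?_, Set.mem_range_self _⟩
    rw [← PiNat.mem_cylinder_iff_eq.1 hx, PiNat.mem_cylinder_iff]
    intro i hi
    simp [baireSeq, initSeg, hi]
  computable_dist := baire_computable_dist

/-- The dense sequence of the unit interval: `⟨a, b⟩ ↦ min (a, b + 1) / (b + 1)`. -/
noncomputable def unitSeq (n : ℕ) : Set.Icc (0 : ℝ) 1 :=
  ⟨((min (Nat.unpair n).1 ((Nat.unpair n).2 + 1) : ℕ) : ℝ) / (((Nat.unpair n).2 : ℝ) + 1), by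
    constructor
    · positivity
    · rw [div_le_one (by positivity)]
      exact_mod_cast min_le_right _ _⟩

/-- An index, in the enumeration of the rationals, of the distance of two members of `unitSeq`. -/
def unitDistIndex (n m : ℕ) : ℕ :=
  let a := min (Nat.unpair n).1 ((Nat.unpair n).2 + 1) * ((Nat.unpair m).2 + 1)
  let b := min (Nat.unpair m).1 ((Nat.unpair m).2 + 1) * ((Nat.unpair n).2 + 1)
  Nat.pair (Nat.pair ((a - b) + (b - a)) 0)
    (((Nat.unpair n).2 + 1) * ((Nat.unpair m).2 + 1) - 1)

theorem primrec_unitDistIndex : Primrec₂ unitDistIndex := by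
  have h1 : Primrec fun t : ℕ × ℕ => (Nat.unpair t.1).1 :=
    Primrec.fst.comp (Primrec.unpair.comp Primrec.fst)
  have h2 : Primrec fun t : ℕ × ℕ => (Nat.unpair t.1).2 + 1 :=
    Primrec.succ.comp (Primrec.snd.comp (Primrec.unpair.comp Primrec.fst))
  have h3 : Primrec fun t : ℕ × ℕ => (Nat.unpair t.2).1 :=
    Primrec.fst.comp (Primrec.unpair.comp Primrec.snd)
  have h4 : Primrec fun t : ℕ × ℕ => (Nat.unpair t.2).2 + 1 :=
    Primrec.succ.comp (Primrec.snd.comp (Primrec.unpair.comp Primrec.snd))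
  have ha := Primrec.nat_mul.comp (Primrec.nat_min.comp h1 h2) h4
  have hb := Primrec.nat_mul.comp (Primrec.nat_min.comp h3 h4) h2
  exact Primrec₂.natPair.comp
    (Primrec₂.natPair.comp
      (Primrec.nat_add.comp (Primrec.nat_sub.comp ha hb) (Primrec.nat_sub.comp hb ha))
      (Primrec.const 0))
    (Primrec.nat_sub.comp (Primrec.nat_mul.comp h2 h4) (Primrec.const 1))

theorem ratEnum_unitDistIndex (n m : ℕ) :
    (ratEnum (unitDistIndex n m) : ℝ) = dist (unitSeq n) (unitSeq m) := by
  rw [Subtype.dist_eq, Real.dist_eq]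
  unfold unitDistIndex unitSeq
  dsimp only
  generalize hu : min (Nat.unpair n).1 ((Nat.unpair n).2 + 1) = u
  generalize hv : min (Nat.unpair m).1 ((Nat.unpair m).2 + 1) = v
  generalize (Nat.unpair n).2 = c
  generalize (Nat.unpair m).2 = d
  rw [ratEnum_pair]
  have hcd : (((c + 1) * (d + 1) - 1 : ℕ) : ℝ) + 1 = ((c : ℝ) + 1) * ((d : ℝ) + 1) := by
    have : (c + 1) * (d + 1) - 1 + 1 = (c + 1) * (d + 1) :=
      Nat.succ_pred_eq_of_pos (Nat.mul_pos c.succ_pos d.succ_pos)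
    exact_mod_cast this
  have hnum : (((u * (d + 1) - v * (c + 1)) + (v * (c + 1) - u * (d + 1)) : ℕ) : ℝ) =
      |(u : ℝ) * ((d : ℝ) + 1) - (v : ℝ) * ((c : ℝ) + 1)| := by
    rcases le_total (u * (d + 1)) (v * (c + 1)) with h | h
    · have h' : (u : ℝ) * ((d : ℝ) + 1) ≤ (v : ℝ) * ((c : ℝ) + 1) := by exact_mod_cast h
      rw [Nat.sub_eq_zero_of_le h, zero_add, Nat.cast_sub h, abs_of_nonpos (by linarith)]
      push_cast
      ring
    · have h' : (v : ℝ) * ((c : ℝ) + 1) ≤ (u : ℝ) * ((d : ℝ) + 1) := by exact_mod_cast h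
      rw [Nat.sub_eq_zero_of_le h, add_zero, Nat.cast_sub h, abs_of_nonneg (by linarith)]
      push_cast
      ring
  rw [Rat.cast_div, Rat.cast_sub, Rat.cast_add, Rat.cast_natCast, Rat.cast_natCast,
    Rat.cast_natCast, Rat.cast_one, hcd, hnum, Nat.cast_zero, sub_zero]
  have hc : (0 : ℝ) < (c : ℝ) + 1 := by positivity
  have hd : (0 : ℝ) < (d : ℝ) + 1 := by positivity
  rw [div_sub_div _ _ hc.ne' hd.ne', abs_div, abs_of_pos (mul_pos hc hd), mul_comm ((c : ℝ) + 1) (v : ℝ)]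

theorem unit_computable_dist : ∃ f : ℕ × ℕ × ℕ → ℕ, Computable f ∧
    ∀ n m : ℕ, IsRealName (fun k => f (n, m, k))
      (dist (unitSeq n) (unitSeq m)) := by
  have h : Primrec fun t : ℕ × ℕ × ℕ => unitDistIndex t.1 t.2.1 :=
    primrec_unitDistIndex.comp Primrec.fst (Primrec.fst.comp Primrec.snd)
  exact ⟨_, h.to_comp, fun n m => isRealName_const (c := unitDistIndex n m)
    (ratEnum_unitDistIndex n m)⟩

/-- The unit interval `[0,1]` with the Euclidean metric. -/
noncomputable def unitIntervalSpace : ComputablePolishSpace where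
  carrier := Set.Icc (0 : ℝ) 1
  metric := inferInstance
  complete := inferInstance
  seq := unitSeq
  dense := by
    intro x
    rw [Metric.mem_closure_range_iff]
    intro ε hε
    obtain ⟨x, hx0, hx1⟩ := x
    obtain ⟨b, hb⟩ := exists_nat_one_div_lt hε
    have hb0 : (0 : ℝ) < (b : ℝ) + 1 := by positivity
    have hle : ⌊x * ((b : ℝ) + 1)⌋₊ ≤ b + 1 := by
      apply Nat.floor_le_of_le
      push_cast
      nlinarith
    refine ⟨Nat.pair ⌊x * ((b : ℝ) + 1)⌋₊ b, ?_⟩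
    rw [Subtype.dist_eq, Real.dist_eq]
    simp only [unitSeq, Nat.unpair_pair]
    rw [min_eq_left hle]
    have h1 := Nat.floor_le (mul_nonneg hx0 hb0.le)
    have h2 := Nat.lt_floor_add_one (x * ((b : ℝ) + 1))
    refine lt_of_le_of_lt ?_ hb
    rw [show x - (⌊x * ((b : ℝ) + 1)⌋₊ : ℝ) / ((b : ℝ) + 1) =
      (x * ((b : ℝ) + 1) - (⌊x * ((b : ℝ) + 1)⌋₊ : ℝ)) / ((b : ℝ) + 1) by field_simp,
      abs_div, abs_of_pos hb0, abs_of_nonneg (by linarith)]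
    gcongr
    linarith
  computable_dist := unit_computable_dist

/-! ### Primitive recursive transformations of names -/

/-! Both reductions use maps from digit sequences to `[0,1]` built by composing contracting affine
maps. Negative information on preimages of closed sets under such a map, and on images of closed
sets of binary sequences, is computable (`exists_preimage`, `exists_image`). What remains is that
uncountability and perfectness survive. They do because the maps fail to be bijective only on
countable sets, while every neighbourhood of a point of a perfect set meets that set in an
uncountable set (`Perfect.not_countable_inter`).

From `[0,1]` to Baire space: a closed `A` is pulled back to the binary sequences by binary
expansion, which is onto, so the preimage is uncountable. A perfect subset of the preimage is
compact, so its image is closed, and a point outside the image is recognised at a finite stage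
(`exists_cover_of_forall_val_ne`). The image has no isolated points, since a number with two binary
expansions has only eventually constant ones (`mem_eventuallyConst_of_binary_val_eq`).

From Baire space to `[0,1]`: alternating expansions embed Baire space into `[0,1]` and miss only
countably many endpoints. The open cells of words whose cylinders are found to avoid `A` are removed
from `[0,1]`. The remaining closed set meets the range of the embedding exactly in the image of `A`;
it may also contain endpoints. The preimage of a perfect subset lies in `A` and is closed, and
discarding countably many endpoints neither empties it nor isolates a point
(`perfect_preimage_alternating`). -/

theorem initSeg_length (p : ℕ → ℕ) (n : ℕ) : (initSeg p n).length = n := by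
  simp [initSeg]

theorem initSeg_getElem (p : ℕ → ℕ) (n i : ℕ) (h : i < (initSeg p n).length) :
    (initSeg p n)[i] = p i := by
  simp [initSeg]

theorem initSeg_getD (p : ℕ → ℕ) {n i : ℕ} (h : i < n) : (initSeg p n).getD i 0 = p i := by
  simp [initSeg, h]

theorem initSeg_take (p : ℕ → ℕ) {m n : ℕ} (h : m ≤ n) : (initSeg p n).take m = initSeg p m := by
  apply List.ext_getElem
  · simp [initSeg, h]
  · intro i h1 h2
    simp [initSeg]

theorem initSeg_succ (p : ℕ → ℕ) (n : ℕ) : initSeg p (n + 1) = initSeg p n ++ [p n] := by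
  simp [initSeg, List.range_succ]

theorem initSeg_succ' (p : ℕ → ℕ) (n : ℕ) :
    initSeg p (n + 1) = p 0 :: initSeg (fun i => p (i + 1)) n := by
  simp [initSeg, List.range_succ_eq_map, Function.comp_def]

theorem initSeg_eq_iff {p q : ℕ → ℕ} {n : ℕ} : initSeg p n = initSeg q n ↔ ∀ i < n, p i = q i := by
  simp [initSeg]

/-- The window of length `2 * n + 2` holds the first `n + 1` entries of both halves of an
interleaved name, so the same form serves for forward and backward translations. -/
theorem type2Computable_of_prefix {g : ℕ → List ℕ → ℕ} (hg : Primrec₂ g) :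
    Type2Computable fun p => Part.some fun n => g n (initSeg p (2 * n + 2)) := by
  have hout : ∀ (p : ℕ → ℕ) (m : ℕ),
      (List.range ((initSeg p m).length / 2)).map
        (fun n => g n ((initSeg p m).take (2 * n + 2))) =
      initSeg (fun n => g n (initSeg p (2 * n + 2))) (m / 2) := by
    intro p m
    rw [initSeg_length]
    apply List.map_congr_left
    intro n hn
    rw [List.mem_range] at hn
    rw [initSeg_take p (by omega)]
  -- An entry is written only once its whole window lies inside `σ`; this gives prefix-monotonicity.
  refine ⟨fun σ => (List.range (σ.length / 2)).map fun n => g n (σ.take (2 * n + 2)), ?_, ?_, ?_⟩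
  · refine (Primrec.list_map ?_ ?_).to_comp
    · exact Primrec.list_range.comp
        (Primrec.nat_div.comp Primrec.list_length (Primrec.const 2))
    · refine hg.comp Primrec.snd (Primrec.list_take.comp ?_ Primrec.fst)
      exact Primrec.nat_add.comp (Primrec.nat_mul.comp (Primrec.const 2) Primrec.snd)
        (Primrec.const 2)
  · intro σ τ h
    have hlen := h.length_le
    rw [List.prefix_iff_eq_take]
    apply List.ext_getElem
    · simp only [List.length_map, List.length_range, List.length_take]
      omega
    · intro i h1 h2
      simp only [List.length_map, List.length_range] at h1
      have : σ.take (2 * i + 2) = τ.take (2 * i + 2) := by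
        obtain ⟨ρ, rfl⟩ := h
        rw [List.take_append_of_le_length (by omega)]
      simp [this]
  · intro p q
    simp only [hout, Part.mem_some_iff]
    constructor
    · rintro rfl n
      exact ⟨2 * n, by simp⟩
    · intro h
      funext n
      obtain ⟨m, hm⟩ := h (n + 1)
      have hlen := hm.length_le
      simp only [initSeg_length] at hlen
      have h1 : n < (initSeg q (n + 1)).length := by simp [initSeg_length]
      have := hm.getElem h1
      rw [initSeg_getElem, initSeg_getElem] at this
      exact this

/-- Clearing denominators and moving the negative parts of the numerators across leaves an
inequality of natural numbers. -/
theorem primrecPred_ratEnum_add_lt :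
    PrimrecPred fun t : ℕ × ℕ × ℕ => ratEnum t.1 + ratEnum t.2.1 < ratEnum t.2.2 := by
  have ha : Primrec fun n : ℕ => n.unpair.1.unpair.1 :=
    Primrec.fst.comp (Primrec.unpair.comp (Primrec.fst.comp Primrec.unpair))
  have hb : Primrec fun n : ℕ => n.unpair.1.unpair.2 :=
    Primrec.snd.comp (Primrec.unpair.comp (Primrec.fst.comp Primrec.unpair))
  have hc : Primrec fun n : ℕ => n.unpair.2 + 1 :=
    Primrec.succ.comp (Primrec.snd.comp Primrec.unpair)
  have h1 : Primrec fun t : ℕ × ℕ × ℕ => t.1 := Primrec.fst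
  have h2 : Primrec fun t : ℕ × ℕ × ℕ => t.2.1 := Primrec.fst.comp Primrec.snd
  have h3 : Primrec fun t : ℕ × ℕ × ℕ => t.2.2 := Primrec.snd.comp Primrec.snd
  have mul3 : ∀ {f g h : ℕ × ℕ × ℕ → ℕ}, Primrec f → Primrec g → Primrec h →
      Primrec fun t => f t * g t * h t := fun hf hg hh =>
    Primrec.nat_mul.comp (Primrec.nat_mul.comp hf hg) hh
  have add3 : ∀ {f g h : ℕ × ℕ × ℕ → ℕ}, Primrec f → Primrec g → Primrec h →
      Primrec fun t => f t + g t + h t := fun hf hg hh =>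
    Primrec.nat_add.comp (Primrec.nat_add.comp hf hg) hh
  refine (Primrec.nat_lt.comp
    (add3 (mul3 (ha.comp h1) (hc.comp h2) (hc.comp h3))
      (mul3 (ha.comp h2) (hc.comp h1) (hc.comp h3))
      (mul3 (hb.comp h3) (hc.comp h1) (hc.comp h2)))
    (add3 (mul3 (hb.comp h1) (hc.comp h2) (hc.comp h3))
      (mul3 (hb.comp h2) (hc.comp h1) (hc.comp h3))
      (mul3 (ha.comp h3) (hc.comp h1) (hc.comp h2)))).of_eq ?_
  rintro ⟨i, j, k⟩
  simp only [ratEnum]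
  generalize i.unpair.2 = c₁
  generalize j.unpair.2 = c₂
  generalize k.unpair.2 = c₃
  rw [div_add_div _ _ (by positivity) (by positivity), div_lt_div_iff₀ (by positivity)
    (by positivity), ← Nat.cast_lt (α := ℚ)]
  push_cast
  constructor <;> intro h <;> linarith

/-! ### Formal inclusion and exclusion of balls -/

/-- A primitive recursive function giving exact rational distances in the dense sequence. -/
structure ExactDist (X : ComputablePolishSpace) where
  index : ℕ → ℕ → ℕ
  primrec : Primrec₂ index
  spec : ∀ n m, (ratEnum (index n m) : ℝ) = dist (X.seq n) (X.seq m)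

def unitExactDist : ExactDist unitIntervalSpace where
  index := unitDistIndex
  primrec := primrec_unitDistIndex
  spec := ratEnum_unitDistIndex

def baireExactDist : ExactDist baireSpace where
  index := baireDistIndex
  primrec := primrec_baireDistIndex
  spec := ratEnum_baireDistIndex

variable {X Y : ComputablePolishSpace}

/-- The closed ball around the `u`-th point with the `ρ`-th rational as radius is formally included
in the `j`-th basic ball. -/
def ExactDist.FormalIn (E : ExactDist X) (u ρ j : ℕ) : Prop :=
  ratEnum (E.index u j.unpair.1) + ratEnum ρ < ratEnum j.unpair.2

/-- The closed ball around the `u`-th point with the `ρ`-th rational as radius is formally disjoint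
from the `j`-th basic ball. -/
def ExactDist.FormalOut (E : ExactDist X) (u ρ j : ℕ) : Prop :=
  ¬ ratEnum (E.index u j.unpair.1) < ratEnum ρ + ratEnum j.unpair.2

theorem ExactDist.formalIn_iff (E : ExactDist X) {u ρ j : ℕ} : E.FormalIn u ρ j ↔
    dist (X.seq u) (X.seq j.unpair.1) + (ratEnum ρ : ℝ) < (ratEnum j.unpair.2 : ℝ) := by
  rw [← E.spec, FormalIn]
  exact_mod_cast Iff.rfl

theorem ExactDist.formalOut_iff (E : ExactDist X) {u ρ j : ℕ} : E.FormalOut u ρ j ↔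
    (ratEnum ρ : ℝ) + (ratEnum j.unpair.2 : ℝ) ≤ dist (X.seq u) (X.seq j.unpair.1) := by
  rw [← E.spec, FormalOut, not_lt]
  exact_mod_cast Iff.rfl

theorem ExactDist.primrecPred_formalIn (E : ExactDist X) {α : Type*} [Primcodable α]
    {u ρ j : α → ℕ} (hu : Primrec u) (hρ : Primrec ρ) (hj : Primrec j) :
    PrimrecPred fun a => E.FormalIn (u a) (ρ a) (j a) := by
  have h : Primrec fun a => (E.index (u a) (j a).unpair.1, ρ a, (j a).unpair.2) :=
    (E.primrec.comp hu (Primrec.fst.comp (Primrec.unpair.comp hj))).pair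
      (hρ.pair (Primrec.snd.comp (Primrec.unpair.comp hj)))
  exact (primrecPred_ratEnum_add_lt.comp h).of_eq fun _ => Iff.rfl

theorem primrecPred_ratEnum_lt_add :
    PrimrecPred fun t : ℕ × ℕ × ℕ => ratEnum t.1 < ratEnum t.2.1 + ratEnum t.2.2 := by
  have ha : Primrec fun n : ℕ => n.unpair.1.unpair.1 :=
    Primrec.fst.comp (Primrec.unpair.comp (Primrec.fst.comp Primrec.unpair))
  have hb : Primrec fun n : ℕ => n.unpair.1.unpair.2 :=
    Primrec.snd.comp (Primrec.unpair.comp (Primrec.fst.comp Primrec.unpair))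
  have hneg : Primrec fun n : ℕ =>
      Nat.pair (Nat.pair n.unpair.1.unpair.2 n.unpair.1.unpair.1) n.unpair.2 :=
    Primrec₂.natPair.comp (Primrec₂.natPair.comp hb ha) (Primrec.snd.comp Primrec.unpair)
  have hneg' : ∀ n : ℕ, ratEnum
      (Nat.pair (Nat.pair n.unpair.1.unpair.2 n.unpair.1.unpair.1) n.unpair.2) = -ratEnum n := by
    intro n
    rw [ratEnum_pair, ratEnum]
    ring
  refine (primrecPred_ratEnum_add_lt.comp (Primrec.fst.pair ((hneg.comp
    (Primrec.fst.comp Primrec.snd)).pair (Primrec.snd.comp Primrec.snd)))).of_eq ?_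
  rintro ⟨i, j, k⟩
  simp only [hneg']
  constructor <;> intro h <;> linarith

theorem ExactDist.primrecPred_formalOut (E : ExactDist X) {α : Type*} [Primcodable α]
    {u ρ j : α → ℕ} (hu : Primrec u) (hρ : Primrec ρ) (hj : Primrec j) :
    PrimrecPred fun a => E.FormalOut (u a) (ρ a) (j a) := by
  have h : Primrec fun a => (E.index (u a) (j a).unpair.1, ρ a, (j a).unpair.2) :=
    (E.primrec.comp hu (Primrec.fst.comp (Primrec.unpair.comp hj))).pair
      (hρ.pair (Primrec.snd.comp (Primrec.unpair.comp hj)))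
  exact (primrecPred_ratEnum_lt_add.comp h).not.of_eq fun _ => Iff.rfl

/-- Index `0` codes radius zero, so writing `0` in a name removes nothing. -/
theorem basicBall_zero : X.basicBall 0 = ∅ := by
  have : ratEnum 0 = 0 := by simp [ratEnum]
  simp [ComputablePolishSpace.basicBall, this]

theorem mem_closedOfName {p : ℕ → ℕ} {x : X.carrier} :
    x ∈ (X.closedOfName p : Set X.carrier) ↔ ∀ i, x ∉ X.basicBall (p i) := by
  change x ∈ (⋃ i, X.basicBall (p i))ᶜ ↔ _
  simp

/-- Cells, indexed by words, given by formal balls in `X`, and an associated ball in `Y` for each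
cell. If a cell is formally included in the complement of the given closed subset of `X`, or is
excluded in advance, then the associated ball is removed from `Y`. -/
structure CellTransfer (X Y : ComputablePolishSpace) where
  center : List ℕ → ℕ
  radius : List ℕ → ℕ
  image : List ℕ → ℕ
  excluded : List ℕ → Prop
  primrec_center : Primrec center
  primrec_radius : Primrec radius
  primrec_image : Primrec image
  primrec_excluded : PrimrecPred excluded

/-- The output index runs over all pairs of a position and a word, so every cell is tested against
every ball of the name. The map `pos` selects which entries to read: all of `p`, or one half of an
interleaved name. -/
theorem CellTransfer.exists_type2Computable (T : CellTransfer X Y) (E : ExactDist X)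
    {pos : ℕ → ℕ} (hpos : Primrec pos) (hle : ∀ i, pos i ≤ 2 * i + 1) :
    ∃ Φ : (ℕ → ℕ) →. (ℕ → ℕ), Type2Computable Φ ∧ ∀ p, ∃ p' ∈ Φ p, ∀ y : Y.carrier,
      y ∈ (Y.closedOfName p' : Set Y.carrier) ↔ ∀ σ, y ∈ Y.basicBall (T.image σ) →
        ¬ T.excluded σ ∧ ∀ i, ¬ E.FormalIn (T.center σ) (T.radius σ) (p (pos i)) := by
  classical
  let word : ℕ → List ℕ := fun n => Denumerable.ofNat (List ℕ) n.unpair.2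
  let g : ℕ → List ℕ → ℕ := fun n s =>
    if T.excluded (word n) ∨ E.FormalIn (T.center (word n)) (T.radius (word n))
      (s.getD (pos n.unpair.1) 0) then T.image (word n) else 0
  have hword : Primrec fun t : ℕ × List ℕ => word t.1 :=
    (Primrec.ofNat _).comp (Primrec.snd.comp (Primrec.unpair.comp Primrec.fst))
  have hg : Primrec₂ g := by
    refine Primrec.ite ((T.primrec_excluded.comp hword).or (E.primrecPred_formalIn
      (T.primrec_center.comp hword) (T.primrec_radius.comp hword) ?_))
      (T.primrec_image.comp hword) (Primrec.const 0)
    exact (Primrec.list_getD 0).comp Primrec.snd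
      (hpos.comp (Primrec.fst.comp (Primrec.unpair.comp Primrec.fst)))
  refine ⟨_, type2Computable_of_prefix hg, fun p => ⟨_, Part.mem_some _, fun y => ?_⟩⟩
  -- Since `n.unpair.1 ≤ n`, the position read lies in the window and the default value never
  -- occurs.
  have hget : ∀ n, (initSeg p (2 * n + 2)).getD (pos n.unpair.1) 0 = p (pos n.unpair.1) := by
    intro n
    apply initSeg_getD
    have := hle n.unpair.1
    have := n.unpair_left_le
    omega
  rw [mem_closedOfName]
  simp only [g, hget]
  constructor
  · intro h σ hy
    by_contra hcon
    obtain ⟨i, hi⟩ : ∃ i, T.excluded σ ∨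
        E.FormalIn (T.center σ) (T.radius σ) (p (pos i)) := by
      by_contra! hne
      exact hcon ⟨(hne 0).1, fun i => (hne i).2⟩
    apply h (Nat.pair i (Encodable.encode σ))
    have hw : word (Nat.pair i (Encodable.encode σ)) = σ := by simp [word]
    rw [hw, Nat.unpair_pair, if_pos hi]
    exact hy
  · intro h n
    split_ifs with hc
    · intro hy
      obtain ⟨h1, h2⟩ := h _ hy
      exact hc.elim h1 (h2 _)
    · rw [basicBall_zero]
      simp

/-! ### Expansions of real numbers given by contracting affine maps -/

theorem primrec_two_pow : Primrec fun k : ℕ => 2 ^ k := by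
  have : Primrec fun k : ℕ => Nat.rec (motive := fun _ => ℕ) 1 (fun _ r => r * 2) k :=
    Primrec.nat_rec₁ 1 (Primrec.nat_mul.comp Primrec.snd (Primrec.const 2))
  refine this.of_eq fun k => ?_
  induction k with
  | zero => rfl
  | succ k ih => rw [pow_succ, ← ih]

theorem cast_two_pow_sub_one_add_one (s : ℕ) : ((2 ^ s - 1 : ℕ) : ℝ) + 1 = 2 ^ s := by
  have : 2 ^ s - 1 + 1 = 2 ^ s := Nat.succ_pred_eq_of_pos (Nat.two_pow_pos s)
  exact_mod_cast this

/-- A sequence of contracting affine maps `t ↦ offset k + slope k * t` of the unit interval into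
itself, together with its primitive recursive action `step` on dyadic rationals, where `(A, s)`
stands for `A / 2 ^ s`. -/
structure DigitSystem where
  offset : ℕ → ℝ
  slope : ℕ → ℝ
  slope_ne_zero : ∀ k, slope k ≠ 0
  abs_slope_le : ∀ k, |slope k| ≤ 1 / 2
  mapsTo : ∀ k, MapsTo (fun t => offset k + slope k * t) (Icc 0 1) (Icc 0 1)
  step : ℕ → ℕ × ℕ → ℕ × ℕ
  primrec_step : Primrec₂ step
  step_le : ∀ k A s, A ≤ 2 ^ s → (step k (A, s)).1 ≤ 2 ^ (step k (A, s)).2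
  step_eq : ∀ k A s, A ≤ 2 ^ s → ((step k (A, s)).1 : ℝ) / 2 ^ (step k (A, s)).2 =
    offset k + slope k * ((A : ℝ) / 2 ^ s)
  step_width : ∀ k A s, ((1 : ℝ) / 2 ^ (step k (A, s)).2) = |slope k| * (1 / 2 ^ s)

namespace DigitSystem

variable (D : DigitSystem)

/-- The affine map of the digit `k`. -/
def map (k : ℕ) (t : ℝ) : ℝ := D.offset k + D.slope k * t

/-- The affine map of a word. -/
def comp (σ : List ℕ) (t : ℝ) : ℝ := σ.foldr D.map t

/-- The centre of the cell of a word as a dyadic rational `A / 2 ^ s`; its radius is `1 / 2 ^ s`. -/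
def code (σ : List ℕ) : ℕ × ℕ := σ.foldr D.step (1, 1)

noncomputable def center (σ : List ℕ) : ℝ := ((D.code σ).1 : ℝ) / 2 ^ (D.code σ).2

noncomputable def radius (σ : List ℕ) : ℝ := 1 / 2 ^ (D.code σ).2

def centerIndex (σ : List ℕ) : ℕ := Nat.pair (D.code σ).1 (2 ^ (D.code σ).2 - 1)

def radiusIndex (σ : List ℕ) : ℕ := Nat.pair (Nat.pair 1 0) (2 ^ (D.code σ).2 - 1)

theorem primrec_code : Primrec D.code :=
  Primrec.list_foldr (h := fun _ t => D.step t.1 t.2) Primrec.id (Primrec.const (1, 1))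
    (D.primrec_step.comp (Primrec.fst.comp Primrec.snd) (Primrec.snd.comp Primrec.snd))

theorem primrec_two_pow_code : Primrec fun σ => 2 ^ (D.code σ).2 - 1 :=
  Primrec.nat_sub.comp (primrec_two_pow.comp (Primrec.snd.comp D.primrec_code)) (Primrec.const 1)

theorem primrec_centerIndex : Primrec D.centerIndex :=
  Primrec₂.natPair.comp (Primrec.fst.comp D.primrec_code) D.primrec_two_pow_code

theorem primrec_radiusIndex : Primrec D.radiusIndex :=
  Primrec₂.natPair.comp (Primrec.const _) D.primrec_two_pow_code

theorem code_le (σ : List ℕ) : (D.code σ).1 ≤ 2 ^ (D.code σ).2 := by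
  induction σ with
  | nil => simp [code]
  | cons k σ ih => exact D.step_le k _ _ ih

theorem unitSeq_centerIndex (σ : List ℕ) : (unitSeq (D.centerIndex σ) : ℝ) = D.center σ := by
  have h : 2 ^ (D.code σ).2 - 1 + 1 = 2 ^ (D.code σ).2 :=
    Nat.succ_pred_eq_of_pos (Nat.two_pow_pos _)
  simp only [unitSeq, centerIndex, Nat.unpair_pair, h, min_eq_left (D.code_le σ),
    cast_two_pow_sub_one_add_one, center]

theorem ratEnum_radiusIndex (σ : List ℕ) : (ratEnum (D.radiusIndex σ) : ℝ) = D.radius σ := by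
  rw [radiusIndex, ratEnum_pair, radius]
  push_cast
  rw [cast_two_pow_sub_one_add_one]
  simp

theorem center_cons (k : ℕ) (σ : List ℕ) : D.center (k :: σ) = D.map k (D.center σ) :=
  D.step_eq k _ _ (D.code_le σ)

theorem radius_cons (k : ℕ) (σ : List ℕ) : D.radius (k :: σ) = |D.slope k| * D.radius σ :=
  D.step_width k _ _

theorem center_nil : D.center [] = 1 / 2 := by simp [center, code]

theorem radius_nil : D.radius [] = 1 / 2 := by simp [radius, code]

theorem center_eq_comp (σ : List ℕ) : D.center σ = D.comp σ (1 / 2) := by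
  induction σ with
  | nil => exact D.center_nil
  | cons k σ ih => rw [center_cons, ih]; rfl

theorem radius_pos (σ : List ℕ) : 0 < D.radius σ := by
  rw [radius]
  positivity

theorem radius_le (σ : List ℕ) : D.radius σ ≤ (1 / 2) ^ (σ.length + 1) := by
  induction σ with
  | nil => simp [radius_nil]
  | cons k σ ih =>
    rw [radius_cons, List.length_cons, pow_succ']
    exact mul_le_mul (D.abs_slope_le k) ih (D.radius_pos σ).le (by norm_num)

/-- The composite is affine, and its slope has modulus `2 * D.radius σ`: the empty word has slope
`1` and radius `1 / 2`, and each digit scales both alike. -/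
theorem abs_comp_sub_comp (σ : List ℕ) (t u : ℝ) :
    |D.comp σ t - D.comp σ u| = 2 * D.radius σ * |t - u| := by
  induction σ with
  | nil => simp [comp, radius_nil]
  | cons k σ ih =>
    have : D.comp (k :: σ) t - D.comp (k :: σ) u = D.slope k * (D.comp σ t - D.comp σ u) := by
      simp only [comp, List.foldr_cons, map]
      ring
    rw [this, abs_mul, ih, radius_cons]
    ring

theorem comp_injective (σ : List ℕ) : Function.Injective (D.comp σ) := by
  intro t u h
  have := D.abs_comp_sub_comp σ t u
  rw [h, sub_self, abs_zero, eq_comm, mul_eq_zero] at this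
  have hr := D.radius_pos σ
  rcases this with h | h
  · linarith
  · exact sub_eq_zero.1 (abs_eq_zero.1 h)

theorem comp_surjective (σ : List ℕ) : Function.Surjective (D.comp σ) := by
  induction σ with
  | nil => exact fun y => ⟨y, rfl⟩
  | cons k σ ih =>
    intro y
    obtain ⟨t, ht⟩ := ih ((y - D.offset k) / D.slope k)
    refine ⟨t, ?_⟩
    have := D.slope_ne_zero k
    change D.offset k + D.slope k * D.comp σ t = y
    rw [ht]
    field_simp
    ring

theorem comp_append (σ τ : List ℕ) (t : ℝ) : D.comp (σ ++ τ) t = D.comp σ (D.comp τ t) :=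
  List.foldr_append

theorem comp_mem (σ : List ℕ) {t : ℝ} (ht : t ∈ Icc (0 : ℝ) 1) : D.comp σ t ∈ Icc (0 : ℝ) 1 := by
  induction σ with
  | nil => exact ht
  | cons k σ ih => exact D.mapsTo k ih

/-- The closed cell is the affine image of the unit interval, so its points are described by their
parameter `t`. -/
theorem abs_comp_sub_center_le_iff (σ : List ℕ) {t : ℝ} :
    |D.comp σ t - D.center σ| ≤ D.radius σ ↔ t ∈ Icc (0 : ℝ) 1 := by
  have hr := D.radius_pos σ
  rw [center_eq_comp, abs_comp_sub_comp, mul_assoc, mul_left_comm, mul_le_iff_le_one_right hr]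
  rw [← le_div_iff₀' two_pos, abs_le, mem_Icc]
  constructor <;> rintro ⟨h1, h2⟩ <;> constructor <;> linarith

theorem abs_comp_sub_center_lt_iff (σ : List ℕ) {t : ℝ} :
    |D.comp σ t - D.center σ| < D.radius σ ↔ t ∈ Ioo (0 : ℝ) 1 := by
  have hr := D.radius_pos σ
  rw [center_eq_comp, abs_comp_sub_comp, mul_assoc, mul_left_comm, mul_lt_iff_lt_one_right hr]
  rw [← lt_div_iff₀' two_pos, abs_lt, mem_Ioo]
  constructor <;> rintro ⟨h1, h2⟩ <;> constructor <;> linarith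

/-! ### Real numbers given by infinite expansions -/

theorem exists_val (x : ℕ → ℕ) :
    ∃ y, Tendsto (fun n => D.comp (initSeg x n) (1 / 2)) atTop (𝓝 y) := by
  refine cauchySeq_tendsto_of_complete
    (cauchySeq_of_le_geometric_two (C := 1) fun n => ?_)
  have hmem : D.comp [x n] (1 / 2) ∈ Icc (0 : ℝ) 1 := D.comp_mem _ (by norm_num)
  -- The next centre is the current affine map applied to a point of the unit interval, so it lies
  -- in the current cell.
  have h := (D.abs_comp_sub_center_le_iff (initSeg x n)).2 hmem
  rw [← comp_append, ← initSeg_succ, center_eq_comp] at h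
  rw [dist_comm, Real.dist_eq]
  refine h.trans ((D.radius_le _).trans ?_)
  rw [initSeg_length, pow_succ', div_pow, one_pow, mul_one_div]

/-- The real number with a given expansion. -/
noncomputable def val (x : ℕ → ℕ) : ℝ := (D.exists_val x).choose

theorem tendsto_val (x : ℕ → ℕ) :
    Tendsto (fun n => D.comp (initSeg x n) (1 / 2)) atTop (𝓝 (D.val x)) :=
  (D.exists_val x).choose_spec

theorem val_mem (x : ℕ → ℕ) : D.val x ∈ Icc (0 : ℝ) 1 :=
  isClosed_Icc.mem_of_tendsto (D.tendsto_val x)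
    (Eventually.of_forall fun _ => D.comp_mem _ (by norm_num))

theorem val_eq_map (x : ℕ → ℕ) : D.val x = D.map (x 0) (D.val fun i => x (i + 1)) := by
  have h1 := (tendsto_add_atTop_iff_nat 1).2 (D.tendsto_val x)
  have h2 := ((D.tendsto_val fun i => x (i + 1)).const_mul (D.slope (x 0))).const_add
    (D.offset (x 0))
  refine tendsto_nhds_unique h1 (h2.congr fun n => ?_)
  rw [initSeg_succ']
  rfl

theorem val_eq_comp (n : ℕ) (x : ℕ → ℕ) :
    D.val x = D.comp (initSeg x n) (D.val fun i => x (i + n)) := by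
  induction n generalizing x with
  | zero => rfl
  | succ n ih => rw [val_eq_map, ih, initSeg_succ']; rfl

theorem abs_val_sub_center_le (x : ℕ → ℕ) (n : ℕ) :
    |D.val x - D.center (initSeg x n)| ≤ D.radius (initSeg x n) := by
  rw [D.val_eq_comp n x]
  exact (D.abs_comp_sub_center_le_iff _).2 (D.val_mem _)

theorem radius_initSeg_le (x : ℕ → ℕ) (n : ℕ) : D.radius (initSeg x n) ≤ (1 / 2) ^ (n + 1) := by
  simpa [initSeg_length] using D.radius_le (initSeg x n)

theorem eq_val_of_forall_abs_le {x : ℕ → ℕ} {y : ℝ}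
    (h : ∀ n, |y - D.center (initSeg x n)| ≤ D.radius (initSeg x n)) : y = D.val x := by
  have h0 : Tendsto (fun n : ℕ => ((1 : ℝ) / 2) ^ (n + 1)) atTop (𝓝 0) :=
    (tendsto_add_atTop_iff_nat 1).2
      (tendsto_pow_atTop_nhds_zero_of_lt_one (by norm_num) (by norm_num))
  have hlim : Tendsto (fun n => D.comp (initSeg x n) (1 / 2)) atTop (𝓝 y) := by
    rw [tendsto_iff_dist_tendsto_zero]
    refine squeeze_zero (fun _ => dist_nonneg) (fun n => ?_) h0
    rw [dist_comm, Real.dist_eq, ← center_eq_comp]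
    exact (h n).trans (D.radius_initSeg_le x n)
  exact tendsto_nhds_unique hlim (D.tendsto_val x)

theorem exists_radius_lt {ε : ℝ} (hε : 0 < ε) (x : ℕ → ℕ) :
    ∃ N, ∀ n ≥ N, D.radius (initSeg x n) < ε := by
  obtain ⟨N, hN⟩ := exists_pow_lt_of_lt_one hε (by norm_num : (1 / 2 : ℝ) < 1)
  refine ⟨N, fun n hn => (D.radius_initSeg_le x n).trans_lt (lt_of_le_of_lt ?_ hN)⟩
  exact pow_le_pow_of_le_one (by norm_num) (by norm_num) (by omega)

theorem continuous_val : Continuous D.val := by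
  rw [continuous_iff_continuousAt]
  intro x
  rw [ContinuousAt, Metric.tendsto_nhds]
  intro ε hε
  obtain ⟨N, hN⟩ := D.exists_radius_lt (half_pos hε) x
  have hopen : PiNat.cylinder (E := fun _ => ℕ) x N ∈ 𝓝 x :=
    (PiNat.isOpen_cylinder (fun _ : ℕ => ℕ) x N).mem_nhds (PiNat.self_mem_cylinder x N)
  filter_upwards [hopen] with z hz
  have heq : initSeg z N = initSeg x N := initSeg_eq_iff.2 hz
  have h1 := D.abs_val_sub_center_le x N
  have h2 := D.abs_val_sub_center_le z N
  rw [heq] at h2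
  have h3 := hN N le_rfl
  rw [Real.dist_eq]
  have := abs_sub_le (D.val z) (D.center (initSeg x N)) (D.val x)
  rw [abs_sub_comm (D.center _) (D.val x)] at this
  linarith

/-- The point of the unit interval with a given expansion. -/
noncomputable def point (x : ℕ → ℕ) : Icc (0 : ℝ) 1 := ⟨D.val x, D.val_mem x⟩

theorem continuous_point : Continuous D.point := D.continuous_val.subtype_mk _

/-- If a formal ball includes the cell of a word then it contains all points of the cell. -/
theorem point_mem_of_formalIn {x : ℕ → ℕ} {n j : ℕ} (h : unitExactDist.FormalIn
    (D.centerIndex (initSeg x n)) (D.radiusIndex (initSeg x n)) j) :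
    D.point x ∈ unitIntervalSpace.basicBall j := by
  rw [ExactDist.formalIn_iff, ratEnum_radiusIndex] at h
  change |(unitSeq _ : ℝ) - (unitSeq _ : ℝ)| + _ < _ at h
  change |D.val x - (unitSeq _ : ℝ)| < _
  rw [unitSeq_centerIndex] at h
  have h1 := D.abs_val_sub_center_le x n
  have := abs_sub_le (D.val x) (D.center (initSeg x n)) (unitSeq j.unpair.1)
  linarith

theorem exists_formalIn_of_point_mem {x : ℕ → ℕ} {j : ℕ}
    (h : D.point x ∈ unitIntervalSpace.basicBall j) :
    ∃ n, unitExactDist.FormalIn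
      (D.centerIndex (initSeg x n)) (D.radiusIndex (initSeg x n)) j := by
  change |D.val x - (unitSeq _ : ℝ)| < _ at h
  obtain ⟨N, hN⟩ := D.exists_radius_lt (half_pos (sub_pos.2 h)) x
  refine ⟨N, ?_⟩
  rw [ExactDist.formalIn_iff, ratEnum_radiusIndex]
  change |(unitSeq _ : ℝ) - (unitSeq _ : ℝ)| + _ < _
  rw [unitSeq_centerIndex]
  have h1 := D.abs_val_sub_center_le x N
  have h2 := hN N le_rfl
  have := abs_sub_le (D.center (initSeg x N)) (D.val x) (unitSeq j.unpair.1)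
  rw [abs_sub_comm (D.center _) (D.val x)] at this
  linarith

end DigitSystem

/-! ### Expansions: existence, and two concrete systems -/

namespace DigitSystem

/-- Iterating a choice of first digit and remainder produces the expansion. `S` is the set of
admissible remainders; it need not be the whole interval, since alternating expansions must avoid
endpoints. -/
theorem exists_val_eq (D : DigitSystem) {S : Set ℝ} {Q : ℕ → Prop} (hS : S ⊆ Icc 0 1)
    (h : ∀ t ∈ S, ∃ k, Q k ∧ ∃ u ∈ S, D.map k u = t) {y : ℝ} (hy : y ∈ S) :
    ∃ x : ℕ → ℕ, (∀ i, Q (x i)) ∧ D.val x = y := by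
  choose! k hQ u hu hku using h
  have hiter : ∀ n, u^[n] y ∈ S := by
    intro n
    induction n with
    | zero => exact hy
    | succ n ih => rw [Function.iterate_succ_apply']; exact hu _ ih
  refine ⟨fun n => k (u^[n] y), fun i => hQ _ (hiter i), (D.eq_val_of_forall_abs_le ?_).symm⟩
  intro n
  have hcomp : y = D.comp (initSeg (fun n => k (u^[n] y)) n) (u^[n] y) := by
    induction n with
    | zero => rfl
    | succ n ih =>
      rw [initSeg_succ, comp_append, Function.iterate_succ_apply']
      change y = D.comp _ (D.map _ (u _))
      rw [hku _ (hiter n), ← ih]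
  nth_rewrite 1 [hcomp]
  exact (D.abs_comp_sub_center_le_iff _).2 (hS (hiter n))

theorem primrec_add_const (c : ℕ) : Primrec fun n : ℕ => n + c :=
  Primrec.nat_add.comp Primrec.id (Primrec.const c)

/-- Binary expansions; every nonzero digit is read as `1`. -/
noncomputable def binary : DigitSystem where
  offset k := if k = 0 then 0 else 1 / 2
  slope _ := 1 / 2
  slope_ne_zero _ := by norm_num
  abs_slope_le _ := by norm_num
  mapsTo k t ht := by
    obtain ⟨h0, h1⟩ := ht
    dsimp only
    split_ifs <;> constructor <;> linarith
  step k a := (if k = 0 then a.1 else a.1 + 2 ^ a.2, a.2 + 1)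
  primrec_step := by
    have h1 : Primrec fun t : ℕ × ℕ × ℕ => t.2.1 := Primrec.fst.comp Primrec.snd
    have h2 : Primrec fun t : ℕ × ℕ × ℕ => t.2.2 := Primrec.snd.comp Primrec.snd
    exact (Primrec.ite (Primrec.eq.comp Primrec.fst (Primrec.const 0)) h1
      (Primrec.nat_add.comp h1 (primrec_two_pow.comp h2))).pair ((primrec_add_const 1).comp h2)
  step_le k A s h := by
    dsimp only
    rw [pow_succ]
    split_ifs <;> omega
  step_eq k A s h := by
    dsimp only
    split_ifs
    · field_simp
      ring
    · push_cast
      field_simp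
      ring
  step_width k A s := by
    rw [abs_of_pos (by norm_num), pow_succ]
    field_simp

/-- Expansions with arbitrary natural numbers as digits: the digit `k` reverses the unit interval
onto `[2 ^ (-k - 1), 2 ^ (-k)]`. -/
noncomputable def alternating : DigitSystem where
  offset k := (1 / 2) ^ k
  -- The reversal keeps every infinite expansion inside the open cells. With increasing maps onto
  -- the same intervals, the constant sequence `0` would have the endpoint `1` as its value.
  slope k := -(1 / 2) ^ (k + 1)
  slope_ne_zero _ := by simp
  abs_slope_le k := by
    rw [abs_neg, abs_of_pos (by positivity)]
    exact pow_le_of_le_one (by norm_num) (by norm_num) (by omega)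
  mapsTo k t ht := by
    obtain ⟨h0, h1⟩ := ht
    have hk : (0 : ℝ) < (1 / 2) ^ k := by positivity
    have hk1 : ((1 : ℝ) / 2) ^ k ≤ 1 := pow_le_one₀ (by norm_num) (by norm_num)
    dsimp only
    rw [pow_succ]
    constructor <;> nlinarith
  -- From `2^(-k) - 2^(-k-1) * (A / 2^s) = (2^(s+1) - A) / 2^(s+k+1)`.
  step k a := (2 ^ (a.2 + 1) - a.1, a.2 + k + 1)
  primrec_step := by
    have h1 : Primrec fun t : ℕ × ℕ × ℕ => t.2.1 := Primrec.fst.comp Primrec.snd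
    have h2 : Primrec fun t : ℕ × ℕ × ℕ => t.2.2 := Primrec.snd.comp Primrec.snd
    exact (Primrec.nat_sub.comp (primrec_two_pow.comp ((primrec_add_const 1).comp h2)) h1).pair
      ((primrec_add_const 1).comp (Primrec.nat_add.comp h2 Primrec.fst))
  step_le k A s h := by
    dsimp only
    refine (Nat.sub_le _ _).trans (Nat.pow_le_pow_right (by norm_num) (by omega))
  step_eq k A s h := by
    dsimp only
    have h' : A ≤ 2 ^ (s + 1) := h.trans (Nat.pow_le_pow_right (by norm_num) (by omega))
    rw [Nat.cast_sub h']
    push_cast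
    simp only [div_pow, one_pow, pow_succ, pow_add]
    field_simp
    ring
  step_width k A s := by
    rw [abs_neg, abs_of_pos (by positivity), div_pow, one_pow, div_mul_div_comm, one_mul, ← pow_add]
    congr 2
    omega

/-! #### Binary expansions -/

theorem exists_binary_val_eq {y : ℝ} (hy : y ∈ Icc (0 : ℝ) 1) :
    ∃ x : ℕ → ℕ, (∀ i, x i < 2) ∧ binary.val x = y := by
  refine binary.exists_val_eq (Q := fun k => k < 2) subset_rfl ?_ hy
  rintro t ⟨h0, h1⟩
  rcases le_total t (1 / 2) with h | h
  · refine ⟨0, by norm_num, 2 * t, ⟨by linarith, by linarith⟩, ?_⟩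
    simp [map, binary]
  · refine ⟨1, by norm_num, 2 * t - 1, ⟨by linarith, by linarith⟩, ?_⟩
    simp [map, binary]
    ring

theorem binary_val_eq_zero {x : ℕ → ℕ} (h : binary.val x = 0) (i : ℕ) : x i = 0 := by
  induction i generalizing x with
  | zero =>
    rw [val_eq_map] at h
    have h0 := (binary.val_mem fun i => x (i + 1)).1
    by_contra hne
    simp only [map, binary, if_neg hne] at h
    simp only [binary] at h0
    linarith
  | succ i ih =>
    refine ih (x := fun i => x (i + 1)) ?_
    rw [val_eq_map] at h
    have h0 := (binary.val_mem fun i => x (i + 1)).1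
    have h1 : 0 ≤ binary.offset (x 0) := by
      simp only [binary]
      split_ifs <;> norm_num
    have h2 : binary.slope (x 0) = 1 / 2 := rfl
    rw [map, h2] at h
    linarith

theorem binary_val_eq_one {x : ℕ → ℕ} (hx : ∀ i, x i < 2) (h : binary.val x = 1) (i : ℕ) :
    x i = 1 := by
  induction i generalizing x with
  | zero =>
    rw [val_eq_map] at h
    have h1 := (binary.val_mem fun i => x (i + 1)).2
    by_contra hne
    have h0 : x 0 = 0 := by have := hx 0; omega
    simp only [map, binary, if_pos h0] at h
    simp only [binary] at h1
    linarith
  | succ i ih =>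
    refine ih (x := fun i => x (i + 1)) (fun i => hx _) ?_
    rw [val_eq_map] at h
    have h0 := (binary.val_mem fun i => x (i + 1)).2
    have h1 : binary.offset (x 0) ≤ 1 / 2 := by
      simp only [binary]
      split_ifs <;> norm_num
    have h2 : binary.slope (x 0) = 1 / 2 := rfl
    rw [map, h2] at h
    linarith

/-- The eventually constant sequences. -/
def eventuallyConst : Set (ℕ → ℕ) := range fun (t : List ℕ × ℕ) i => t.1.getD i t.2

theorem countable_eventuallyConst : eventuallyConst.Countable := countable_range _

theorem mem_eventuallyConst {x : ℕ → ℕ} {n c : ℕ} (h : ∀ i, x (i + n) = c) :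
    x ∈ eventuallyConst := by
  refine ⟨(initSeg x n, c), ?_⟩
  funext i
  rcases lt_or_ge i n with hi | hi
  · simp [initSeg, hi]
  · have := h (i - n)
    rw [Nat.sub_add_cancel hi] at this
    simp [initSeg, hi, this]

/-- At the first differing digit the remainders satisfy `t / 2 = 1 / 2 + u / 2` in `[0,1]`, up to
exchange. This forces `t = 1` and `u = 0`, hence constant tails. -/
theorem mem_eventuallyConst_of_binary_val_eq {x z : ℕ → ℕ} (hx : ∀ i, x i < 2)
    (hz : ∀ i, z i < 2) (hne : x ≠ z) (h : binary.val x = binary.val z) :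
    x ∈ eventuallyConst := by
  classical
  have hex : ∃ n, x n ≠ z n := by
    by_contra! hcon
    exact hne (funext hcon)
  obtain ⟨n, hn, hmin⟩ : ∃ n, x n ≠ z n ∧ ∀ i < n, x i = z i :=
    ⟨Nat.find hex, Nat.find_spec hex, fun i hi => not_not.1 (Nat.find_min hex hi)⟩
  rw [binary.val_eq_comp n x, binary.val_eq_comp n z, initSeg_eq_iff.2 hmin] at h
  have h' := binary.comp_injective _ h
  rw [val_eq_map, binary.val_eq_map fun i => z (i + n)] at h'
  simp only [zero_add] at h'
  have hxm := binary.val_mem fun i => x (i + 1 + n)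
  have hzm := binary.val_mem fun i => z (i + 1 + n)
  have hxn := hx n
  have hzn := hz n
  have h2 : ∀ k, binary.slope k = 1 / 2 := fun _ => rfl
  have ho0 : binary.offset 0 = 0 := by simp [binary]
  have ho1 : binary.offset 1 = 1 / 2 := by simp [binary]
  rcases Nat.lt_or_ge (x n) (z n) with hlt | hge
  · rw [show x n = 0 by omega, show z n = 1 by omega, map, map, h2, h2, ho0, ho1] at h'
    have h1 : binary.val (fun i => x (i + 1 + n)) = 1 := by linarith [hxm.2, hzm.1]
    have := binary_val_eq_one (fun _ => hx _) h1
    exact mem_eventuallyConst (n := n + 1) (c := 1) fun i =>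
      (congrArg x (by omega : i + (n + 1) = i + 1 + n)).trans (this i)
  · rw [show x n = 1 by omega, show z n = 0 by omega, map, map, h2, h2, ho0, ho1] at h'
    have h1 : binary.val (fun i => x (i + 1 + n)) = 0 := by linarith [hxm.1, hzm.2]
    have := binary_val_eq_zero h1
    exact mem_eventuallyConst (n := n + 1) (c := 0) fun i =>
      (congrArg x (by omega : i + (n + 1) = i + 1 + n)).trans (this i)

/-! #### Alternating expansions -/

theorem alternating_map_mem (k : ℕ) {t : ℝ} (ht : t ∈ Ioo (0 : ℝ) 1) :
    alternating.map k t ∈ Ioo ((1 / 2 : ℝ) ^ (k + 1)) ((1 / 2) ^ k) := by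
  have hk : (0 : ℝ) < (1 / 2) ^ k := by positivity
  obtain ⟨h0, h1⟩ := ht
  simp only [map, alternating]
  rw [pow_succ]
  constructor <;> nlinarith

theorem Ioo_pow_subset (k : ℕ) : Ioo ((1 / 2 : ℝ) ^ (k + 1)) ((1 / 2) ^ k) ⊆ Ioo 0 1 :=
  Ioo_subset_Ioo (by positivity) (pow_le_one₀ (by norm_num) (by norm_num))

theorem alternating_comp_mem (σ : List ℕ) {t : ℝ} (ht : t ∈ Ioo (0 : ℝ) 1) :
    alternating.comp σ t ∈ Ioo (0 : ℝ) 1 := by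
  induction σ with
  | nil => exact ht
  | cons k σ ih => exact Ioo_pow_subset k (alternating_map_mem k ih)

/-- Different digits send the open unit interval into disjoint dyadic intervals. -/
theorem alternating_map_injective {k j : ℕ} {t u : ℝ} (ht : t ∈ Ioo (0 : ℝ) 1)
    (hu : u ∈ Ioo (0 : ℝ) 1) (h : alternating.map k t = alternating.map j u) : k = j ∧ t = u := by
  have h1 := alternating_map_mem k ht
  have h2 := alternating_map_mem j hu
  rw [← h] at h2
  have lt_of : ∀ a b : ℕ, (1 / 2 : ℝ) ^ (a + 1) < (1 / 2) ^ b → b < a + 1 := by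
    intro a b hab
    by_contra hcon
    exact absurd (pow_le_pow_of_le_one (by norm_num) (by norm_num) (not_lt.1 hcon))
      (not_le.2 hab)
  have := lt_of k j (h1.1.trans h2.2)
  have := lt_of j k (h2.1.trans h1.2)
  obtain rfl : k = j := by omega
  exact ⟨rfl, alternating.comp_injective [k] h⟩

theorem alternating_comp_eq {σ τ : List ℕ} (hlen : σ.length = τ.length) {t u : ℝ}
    (ht : t ∈ Ioo (0 : ℝ) 1) (hu : u ∈ Ioo (0 : ℝ) 1)
    (h : alternating.comp σ t = alternating.comp τ u) : σ = τ := by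
  induction σ generalizing τ with
  | nil => exact (List.length_eq_zero_iff.1 hlen.symm).symm
  | cons k σ ih =>
    cases τ with
    | nil => simp at hlen
    | cons j τ =>
      obtain ⟨rfl, h'⟩ := alternating_map_injective (alternating_comp_mem σ ht)
        (alternating_comp_mem τ hu) h
      rw [ih (by simpa using hlen) h']

theorem alternating_val_pos (x : ℕ → ℕ) : 0 < alternating.val x := by
  rw [val_eq_map]
  have h := (alternating.val_mem fun i => x (i + 1)).2
  generalize alternating.val (fun i => x (i + 1)) = t at h
  have hk : (0 : ℝ) < (1 / 2) ^ x 0 := by positivity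
  simp only [map, alternating, pow_succ]
  nlinarith

theorem alternating_val_mem (x : ℕ → ℕ) : alternating.val x ∈ Ioo (0 : ℝ) 1 := by
  refine ⟨alternating_val_pos x, ?_⟩
  rw [val_eq_map]
  have h := alternating_val_pos fun i => x (i + 1)
  generalize alternating.val (fun i => x (i + 1)) = t at h
  have hk : (0 : ℝ) < (1 / 2) ^ x 0 := by positivity
  have hk1 : ((1 : ℝ) / 2) ^ x 0 ≤ 1 := pow_le_one₀ (by norm_num) (by norm_num)
  simp only [map, alternating, pow_succ]
  nlinarith

/-- Values lie in the open cells of their prefixes, and open cells of distinct words of equal length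
are disjoint. Cylinders are thus traces of open balls, which makes the alternating map a topological
embedding. -/
theorem alternating_abs_lt_iff {x : ℕ → ℕ} {σ : List ℕ} :
    |alternating.val x - alternating.center σ| < alternating.radius σ ↔
      initSeg x σ.length = σ := by
  constructor
  · intro h
    obtain ⟨t, ht⟩ := alternating.comp_surjective σ (alternating.val x)
    rw [← ht, abs_comp_sub_center_lt_iff] at h
    rw [alternating.val_eq_comp σ.length x] at ht
    exact (alternating_comp_eq (initSeg_length _ _).symm h (alternating_val_mem _) ht).symm
  · intro h
    rw [alternating.val_eq_comp σ.length x, h, abs_comp_sub_center_lt_iff]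
    exact alternating_val_mem _

theorem alternating_val_injective : Function.Injective alternating.val := by
  intro x z h
  have heq : ∀ n, initSeg z n = initSeg x n := by
    intro n
    have := (alternating_abs_lt_iff (x := x) (σ := initSeg x n)).2 (by rw [initSeg_length])
    rw [h, alternating_abs_lt_iff, initSeg_length] at this
    exact this
  funext n
  exact (initSeg_eq_iff.1 (heq (n + 1)) n (by omega)).symm

/-- The countably many numbers without an infinite alternating expansion. -/
def alternatingEndpoints : Set ℝ := range fun σ => alternating.comp σ 0

theorem countable_alternatingEndpoints : alternatingEndpoints.Countable := countable_range _

theorem exists_alternating_val_eq {y : ℝ} (hy : y ∈ Icc (0 : ℝ) 1)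
    (hend : y ∉ alternatingEndpoints) : ∃ x : ℕ → ℕ, alternating.val x = y := by
  -- The right end `1` also has the form `comp σ 0`, so `alternatingEndpoints` accounts for both
  -- ends.
  have hone : alternating.comp [0] 0 = 1 := by simp [comp, map, alternating]
  have hIoo : ∀ t ∈ Icc (0 : ℝ) 1, t ∉ alternatingEndpoints → t ∈ Ioo (0 : ℝ) 1 := by
    intro t ht hte
    refine ⟨lt_of_le_of_ne ht.1 ?_, lt_of_le_of_ne ht.2 ?_⟩
    · rintro rfl
      exact hte ⟨[], rfl⟩
    · rintro rfl
      exact hte ⟨[0], hone⟩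
  suffices h : ∀ t ∈ Icc (0 : ℝ) 1 \ alternatingEndpoints, ∃ k, True ∧
      ∃ u ∈ Icc (0 : ℝ) 1 \ alternatingEndpoints, alternating.map k u = t by
    obtain ⟨x, -, hx⟩ := alternating.exists_val_eq (Q := fun _ => True) sdiff_subset h ⟨hy, hend⟩
    exact ⟨x, hx⟩
  rintro t ⟨ht, hte⟩
  have ht' := hIoo t ht hte
  obtain ⟨k, hk1, hk2⟩ := exists_nat_pow_near_of_lt_one ht'.1 ht'.2.le
    (by norm_num : (0 : ℝ) < 1 / 2) (by norm_num)
  have hpow : (0 : ℝ) < (1 / 2) ^ (k + 1) := by positivity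
  have hmap : alternating.map k (((1 / 2) ^ k - t) / (1 / 2) ^ (k + 1)) = t := by
    simp only [map, alternating]
    field_simp
    ring
  refine ⟨k, trivial, _, ⟨⟨?_, ?_⟩, ?_⟩, hmap⟩
  · exact div_nonneg (by linarith) hpow.le
  · rw [div_le_one hpow]
    have : ((1 : ℝ) / 2) ^ k = 2 * (1 / 2) ^ (k + 1) := by rw [pow_succ]; ring
    linarith
  -- If the remainder were an endpoint, prefixing the digit `k` would exhibit `t` as one.
  · rintro ⟨σ, hσ⟩
    apply hte
    refine ⟨k :: σ, ?_⟩
    rw [← hmap, ← hσ]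
    rfl

end DigitSystem

/-! ### Words and cylinders in Baire space -/

/-- An index of the rational number `2 / 2 ^ n`, where `n` is the length of the word. -/
def wordRadius (σ : List ℕ) : ℕ := Nat.pair (Nat.pair 2 0) (2 ^ σ.length - 1)

/-- An index of the cylinder of a word as a basic ball. -/
def wordBall (σ : List ℕ) : ℕ := Nat.pair (Encodable.encode σ) (wordRadius σ)

theorem primrec_wordRadius : Primrec wordRadius :=
  Primrec₂.natPair.comp (Primrec.const _)
    (Primrec.nat_sub.comp (primrec_two_pow.comp Primrec.list_length) (Primrec.const 1))

theorem primrec_wordBall : Primrec wordBall :=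
  Primrec₂.natPair.comp Primrec.encode primrec_wordRadius

theorem ratEnum_wordRadius (σ : List ℕ) :
    (ratEnum (wordRadius σ) : ℝ) = 2 * (1 / 2) ^ σ.length := by
  rw [wordRadius, ratEnum_pair]
  push_cast
  rw [cast_two_pow_sub_one_add_one, one_div, inv_pow]
  ring

theorem baireSeq_encode (σ : List ℕ) : baireSeq (Encodable.encode σ) = fun i => σ.getD i 0 := by
  funext i
  simp [baireSeq]

theorem initSeg_getD_self (σ : List ℕ) : initSeg (fun i => σ.getD i 0) σ.length = σ := by
  apply List.ext_getElem
  · simp [initSeg]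
  · intro i h1 h2
    simp [initSeg, h2]

theorem dist_word_le {x : ℕ → ℕ} {σ : List ℕ} (h : initSeg x σ.length = σ) :
    dist (α := baireSpace.carrier) x (baireSeq (Encodable.encode σ)) ≤ (1 / 2) ^ σ.length := by
  refine PiNat.mem_cylinder_iff_dist_le.1 (PiNat.mem_cylinder_iff.2 (initSeg_eq_iff.1 ?_))
  rw [h, baireSeq_encode, initSeg_getD_self]

/-- Nonzero distances are powers of `1 / 2`, so a distance below `2 * (1 / 2) ^ n` is at most `(1 /
2) ^ n`, which means agreement on the first `n` entries. -/
theorem mem_basicBall_wordBall {x : ℕ → ℕ} {σ : List ℕ} :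
    x ∈ baireSpace.basicBall (wordBall σ) ↔ initSeg x σ.length = σ := by
  have hmem : x ∈ baireSpace.basicBall (wordBall σ) ↔
      dist (α := baireSpace.carrier) x (baireSeq (Encodable.encode σ)) <
        2 * (1 / 2) ^ σ.length := by
    rw [← ratEnum_wordRadius, ComputablePolishSpace.basicBall, wordBall, Nat.unpair_pair]
    rfl
  rw [hmem]
  constructor
  · intro h
    nth_rewrite 2 [← initSeg_getD_self σ]
    rw [initSeg_eq_iff]
    intro i hi
    rw [← congrFun (baireSeq_encode σ) i]
    obtain ⟨m, hm⟩ : ∃ m, σ.length = m + 1 := ⟨σ.length - 1, by omega⟩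
    rw [hm, pow_succ] at h
    refine PiNat.apply_eq_of_dist_lt (n := m) (lt_of_lt_of_le h ?_) (by omega)
    linarith
  · intro h
    have : (0 : ℝ) < (1 / 2) ^ σ.length := by positivity
    linarith [dist_word_le h]

theorem mem_of_formalIn_word {x : ℕ → ℕ} {σ : List ℕ} (hx : initSeg x σ.length = σ) {j : ℕ}
    (h : baireExactDist.FormalIn (Encodable.encode σ) (wordRadius σ) j) :
    x ∈ baireSpace.basicBall j := by
  rw [ExactDist.formalIn_iff, ratEnum_wordRadius] at h
  have h1 := dist_word_le hx
  have h2 := dist_triangle (α := baireSpace.carrier) x (baireSeq (Encodable.encode σ))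
    (baireSeq j.unpair.1)
  have h3 : (0 : ℝ) < (1 / 2) ^ σ.length := by positivity
  change dist (α := baireSpace.carrier) (baireSeq (Encodable.encode σ)) (baireSeq j.unpair.1) + _
    < _ at h
  change dist (α := baireSpace.carrier) x (baireSeq j.unpair.1) < _
  linarith

/-- The centre moves by at most `(1 / 2) ^ n` and the new radius is `(1 / 2) ^ n`; together they use
up exactly the old radius. -/
theorem formalIn_word_succ {x : ℕ → ℕ} {n j : ℕ}
    (h : baireExactDist.FormalIn (Encodable.encode (initSeg x n)) (wordRadius (initSeg x n)) j) :
    baireExactDist.FormalIn (Encodable.encode (initSeg x (n + 1)))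
      (wordRadius (initSeg x (n + 1))) j := by
  rw [ExactDist.formalIn_iff, ratEnum_wordRadius, initSeg_length] at h ⊢
  change dist (α := baireSpace.carrier) (baireSeq _) (baireSeq j.unpair.1) + _ < _ at h
  change dist (α := baireSpace.carrier) (baireSeq _) (baireSeq j.unpair.1) + _ < _
  have h1 := dist_triangle (α := baireSpace.carrier)
    (baireSeq (Encodable.encode (initSeg x (n + 1)))) (baireSeq (Encodable.encode (initSeg x n)))
    (baireSeq j.unpair.1)
  have h2 : dist (α := baireSpace.carrier) (baireSeq (Encodable.encode (initSeg x (n + 1))))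
      (baireSeq (Encodable.encode (initSeg x n))) ≤ (1 / 2) ^ (initSeg x n).length := by
    apply dist_word_le
    rw [baireSeq_encode, initSeg_length, initSeg_eq_iff]
    intro i hi
    exact initSeg_getD x (by omega)
  rw [initSeg_length] at h2
  rw [pow_succ]
  linarith

theorem exists_formalIn_word {x : ℕ → ℕ} {j : ℕ} (h : x ∈ baireSpace.basicBall j) :
    ∃ N, ∀ n ≥ N, baireExactDist.FormalIn (Encodable.encode (initSeg x n))
      (wordRadius (initSeg x n)) j := by
  change dist (α := baireSpace.carrier) x (baireSeq j.unpair.1) < _ at h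
  -- The divisor three covers the distance from `x` to the centre, at most `(1 / 2) ^ N`, plus the
  -- radius `2 * (1 / 2) ^ N`.
  obtain ⟨N, hN⟩ := exists_pow_lt_of_lt_one (div_pos (sub_pos.2 h) three_pos)
    (by norm_num : (1 / 2 : ℝ) < 1)
  refine ⟨N, fun n hn => ?_⟩
  induction n, hn using Nat.le_induction with
  | succ n hn ih => exact formalIn_word_succ ih
  | base =>
    rw [ExactDist.formalIn_iff, ratEnum_wordRadius, initSeg_length]
    change dist (α := baireSpace.carrier) (baireSeq _) (baireSeq j.unpair.1) + _ < _
    have h1 := dist_triangle_left (α := baireSpace.carrier)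
      (baireSeq (Encodable.encode (initSeg x N))) (baireSeq j.unpair.1) x
    have h2 := dist_word_le (x := x) (σ := initSeg x N) (by rw [initSeg_length])
    rw [initSeg_length] at h2
    linarith

theorem isOpen_setOf_initSeg (R : List ℕ → Prop) (n : ℕ) : IsOpen {x | R (initSeg x n)} := by
  rw [isOpen_iff_mem_nhds]
  intro x hx
  refine mem_of_superset ((PiNat.isOpen_cylinder (fun _ : ℕ => ℕ) x n).mem_nhds
    (PiNat.self_mem_cylinder x n)) fun z hz => ?_
  have : initSeg z n = initSeg x n := initSeg_eq_iff.2 hz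
  rwa [mem_ofPred_eq, this]

theorem exists_initSeg_subset_of_mem_nhds {x : ℕ → ℕ} {U : Set (ℕ → ℕ)} (hU : U ∈ 𝓝 x) :
    ∃ n, ∀ z, initSeg z n = initSeg x n → z ∈ U := by
  obtain ⟨_, ⟨z, n, rfl⟩, hx, hsub⟩ :=
    (PiNat.isTopologicalBasis_cylinders fun _ : ℕ => ℕ).mem_nhds_iff.1 hU
  refine ⟨n, fun w hw => hsub ?_⟩
  rw [← PiNat.mem_cylinder_iff_eq.1 hx]
  exact initSeg_eq_iff.1 hw

/-- The sequences with binary digits. -/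
def binarySeqs : Set (ℕ → ℕ) := {x | ∀ i, x i < 2}

theorem isCompact_binarySeqs : IsCompact binarySeqs := by
  have : binarySeqs = Set.pi univ fun _ => Iio 2 := by
    ext x
    simp [binarySeqs]
  rw [this]
  exact isCompact_univ_pi fun _ => (finite_Iio 2).isCompact

/-- The list of all binary words of length `n`. -/
def binaryWords (n : ℕ) : List (List ℕ) :=
  Nat.rec [[]] (fun _ L => L.flatMap fun w => [0 :: w, 1 :: w]) n

theorem primrec_binaryWords : Primrec binaryWords := by
  refine Primrec.nat_rec₁ [[]] (f := fun _ L => L.flatMap fun w => [0 :: w, 1 :: w]) ?_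
  refine Primrec.list_flatMap Primrec.snd ?_
  exact Primrec.list_cons.comp (Primrec.list_cons.comp (Primrec.const 0) Primrec.snd)
    (Primrec.list_cons.comp (Primrec.list_cons.comp (Primrec.const 1) Primrec.snd)
      (Primrec.const []))

theorem mem_binaryWords {n : ℕ} {w : List ℕ} :
    w ∈ binaryWords n ↔ w.length = n ∧ ∀ d ∈ w, d < 2 := by
  induction n generalizing w with
  | zero =>
    change w ∈ [[]] ↔ _
    rw [List.mem_singleton, List.length_eq_zero_iff]
    constructor
    · rintro rfl
      simp
    · exact fun h => h.1
  | succ n ih =>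
    change w ∈ (binaryWords n).flatMap _ ↔ _
    rw [List.mem_flatMap]
    constructor
    · rintro ⟨v, hv, hw⟩
      obtain ⟨h1, h2⟩ := ih.1 hv
      rcases List.mem_pair.1 hw with rfl | rfl <;> simpa [h1] using h2
    · rintro ⟨h1, h2⟩
      obtain ⟨d, v, rfl⟩ := List.exists_cons_of_length_eq_add_one h1
      refine ⟨v, ih.2 ⟨by simpa using h1, fun e he => h2 e (List.mem_cons_of_mem _ he)⟩, ?_⟩
      have := h2 d List.mem_cons_self
      interval_cases d <;> simp

/-! ### Perfect sets -/

theorem not_countable_nat_to_bool : ¬ Countable (ℕ → Bool) := by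
  intro h
  obtain ⟨f, hf⟩ := exists_surjective_nat (ℕ → Bool)
  obtain ⟨n, hn⟩ := hf fun n => !f n n
  have := congrFun hn n
  simp at this

theorem Perfect.not_countable {α : Type*} [MetricSpace α] [CompleteSpace α] {C : Set α}
    (hC : Perfect C) (hne : C.Nonempty) : ¬ C.Countable := by
  intro h
  obtain ⟨f, hf, -, hinj⟩ := hC.exists_nat_bool_injection hne
  have := (h.mono hf).preimage_of_injOn hinj.injOn
  rw [preimage_range] at this
  exact not_countable_nat_to_bool (countable_univ_iff.1 this)

/-- The closure of the part of `C` in a small ball around `x` is a nonempty perfect set contained in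
`U ∩ C`. -/
theorem Perfect.not_countable_inter {α : Type*} [MetricSpace α] [CompleteSpace α] {C U : Set α}
    (hC : Perfect C) {x : α} (hx : x ∈ C) (hU : U ∈ 𝓝 x) : ¬ (U ∩ C).Countable := by
  obtain ⟨ε, hε, hball⟩ := Metric.nhds_basis_closedBall.mem_iff.1 hU
  obtain ⟨h1, h2⟩ := hC.closure_nhds_inter x hx (Metric.mem_ball_self hε) Metric.isOpen_ball
  refine fun hcount => h1.not_countable h2 (hcount.mono ?_)
  refine subset_inter ?_ (closure_minimal inter_subset_right hC.closed)
  exact (closure_mono (inter_subset_left.trans Metric.ball_subset_closedBall)).trans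
    (Metric.isClosed_closedBall.closure_eq.subset.trans hball)

theorem exists_mem_notMem_of_not_countable {α : Type*} {C E : Set α} (hC : ¬ C.Countable)
    (hE : E.Countable) : ∃ x ∈ C, x ∉ E := by
  by_contra! h
  exact hC (hE.mono h)

/-! ### Preimages under the point map, and images of compact sets -/

namespace DigitSystem

variable (D : DigitSystem)

/-- The cells of a digit system as subsets of the unit interval, together with the cylinders of
their words. -/
def preimageTransfer {excluded : List ℕ → Prop} (h : PrimrecPred excluded) :
    CellTransfer unitIntervalSpace baireSpace where
  center := D.centerIndex
  radius := D.radiusIndex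
  image := wordBall
  excluded := excluded
  primrec_center := D.primrec_centerIndex
  primrec_radius := D.primrec_radiusIndex
  primrec_image := primrec_wordBall
  primrec_excluded := h

/-- Preimages of closed sets under the point map are computable. -/
theorem exists_preimage {excluded : List ℕ → Prop} (h : PrimrecPred excluded)
    {pos : ℕ → ℕ} (hpos : Primrec pos) (hle : ∀ i, pos i ≤ 2 * i + 1) :
    ∃ Φ : (ℕ → ℕ) →. (ℕ → ℕ), Type2Computable Φ ∧ ∀ p, ∃ p' ∈ Φ p, ∀ x : ℕ → ℕ,
      x ∈ (baireSpace.closedOfName p' : Set baireSpace.carrier) ↔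
        (∀ n, ¬ excluded (initSeg x n)) ∧
          D.point x ∈ (unitIntervalSpace.closedOfName fun i => p (pos i) :
            Set unitIntervalSpace.carrier) := by
  obtain ⟨Φ, hΦ, hspec⟩ :=
    (D.preimageTransfer h).exists_type2Computable unitExactDist hpos hle
  refine ⟨Φ, hΦ, fun p => ?_⟩
  obtain ⟨p', hp', hmem⟩ := hspec p
  refine ⟨p', hp', fun x => ?_⟩
  refine (hmem x).trans (Iff.trans ?_ (and_congr Iff.rfl mem_closedOfName.symm))
  constructor
  · intro hx
    have hx' : ∀ n, _ := fun n =>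
      hx (initSeg x n) (mem_basicBall_wordBall.2 (by rw [initSeg_length]))
    refine ⟨fun n => (hx' n).1, fun i hi => ?_⟩
    obtain ⟨n, hn⟩ := D.exists_formalIn_of_point_mem hi
    exact (hx' n).2 i hn
  · rintro ⟨h1, h2⟩ σ hσ
    have hσ' := mem_basicBall_wordBall.1 hσ
    refine ⟨?_, fun i hi => h2 i ?_⟩
    · rw [← hσ']
      exact h1 _
    · refine D.point_mem_of_formalIn (x := x) (n := σ.length) ?_
      rwa [hσ']

/-! ### Negative information on images of compact sets -/

theorem abs_sub_center_le_of_succ {x : ℕ → ℕ} {n : ℕ} {y : ℝ}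
    (h : |y - D.center (initSeg x (n + 1))| ≤ D.radius (initSeg x (n + 1))) :
    |y - D.center (initSeg x n)| ≤ D.radius (initSeg x n) := by
  obtain ⟨t, rfl⟩ := D.comp_surjective (initSeg x (n + 1)) y
  rw [abs_comp_sub_center_le_iff] at h
  rw [initSeg_succ, comp_append, abs_comp_sub_center_le_iff]
  exact D.comp_mem _ h

/-- The cells that cover a point outside the image of a compact set of binary sequences are
eventually all contained in the complement of the compact set. -/
theorem exists_cover_of_forall_val_ne {q : ℕ → ℕ} {y : ℝ}
    (h : ∀ x ∈ binarySeqs, x ∈ (baireSpace.closedOfName q : Set baireSpace.carrier) →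
      D.val x ≠ y) :
    ∃ m, ∀ w ∈ binaryWords m, D.radius w < |y - D.center w| ∨
      ∃ i < m, baireExactDist.FormalIn (Encodable.encode w) (wordRadius w) (q i) := by
  -- `S m` consists of the binary sequences not ruled out at stage `m`. These sets are compact and
  -- decreasing, and a common point would belong to the closed set and have value `y`; so some `S m`
  -- is empty.
  let R : ℕ → List ℕ → Prop := fun m w => |y - D.center w| ≤ D.radius w ∧
    ∀ i < m, ¬ baireExactDist.FormalIn (Encodable.encode w) (wordRadius w) (q i)
  let S : ℕ → Set (ℕ → ℕ) := fun m => binarySeqs ∩ {x | R m (initSeg x m)}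
  have hclosed : ∀ m, IsClosed (S m) := fun m =>
    isCompact_binarySeqs.isClosed.inter
      ⟨isOpen_setOf_initSeg (fun w => ¬ R m w) m⟩
  have hanti : ∀ m, S (m + 1) ⊆ S m := fun m x hx =>
    ⟨hx.1, D.abs_sub_center_le_of_succ hx.2.1, fun i hi hin =>
      hx.2.2 i (by omega) (formalIn_word_succ hin)⟩
  obtain ⟨m, hm⟩ : ∃ m, ¬ (S m).Nonempty := by
    by_contra! hne
    obtain ⟨x, hx⟩ := IsCompact.nonempty_iInter_of_sequence_nonempty_isCompact_isClosed S hanti hne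
      (isCompact_binarySeqs.of_isClosed_subset (hclosed 0) inter_subset_left) hclosed
    rw [mem_iInter] at hx
    refine h x (hx 0).1 (mem_closedOfName.2 fun i hi => ?_)
      (D.eq_val_of_forall_abs_le fun n => (hx n).2.1).symm
    obtain ⟨N, hN⟩ := exists_formalIn_word hi
    exact (hx (max N (i + 1))).2.2 i (by omega) (hN _ (le_max_left _ _))
  refine ⟨m, fun w hw => ?_⟩
  by_contra! hcon
  obtain ⟨hlen, hdig⟩ := mem_binaryWords.1 hw
  -- A surviving word, extended by zeros, would be an element of the empty set `S m`.
  refine hm ⟨fun i => w.getD i 0, fun i => ?_, ?_⟩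
  · change w.getD i 0 < 2
    rcases lt_or_ge i w.length with hi | hi
    · rw [List.getD_eq_getElem _ _ hi]
      exact hdig _ (List.getElem_mem hi)
    · rw [List.getD_eq_default _ _ hi]
      norm_num
  · change R m (initSeg _ m)
    rw [← hlen, initSeg_getD_self, hlen]
    exact hcon

theorem formalOut_iff {w : List ℕ} {j : ℕ} :
    unitExactDist.FormalOut (D.centerIndex w) (D.radiusIndex w) j ↔
      D.radius w + (ratEnum j.unpair.2 : ℝ) ≤ |D.center w - unitSeq j.unpair.1| := by
  rw [ExactDist.formalOut_iff, ratEnum_radiusIndex, ← unitSeq_centerIndex]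
  rfl

/-- A point outside finitely many cells has a basic neighbourhood formally disjoint from them. -/
theorem exists_formalOut (y : Icc (0 : ℝ) 1) (L : List (List ℕ)) :
    ∃ j, y ∈ unitIntervalSpace.basicBall j ∧ ∀ w ∈ L, D.radius w < |(y : ℝ) - D.center w| →
      unitExactDist.FormalOut (D.centerIndex w) (D.radiusIndex w) j := by
  -- Only finitely many gaps occur, so one `δ` fits in all of them; half of it bounds the
  -- displacement of the centre and half the radius.
  have hev : ∀ᶠ δ in 𝓝[>] (0 : ℝ), ∀ w ∈ {w | w ∈ L}, D.radius w < |(y : ℝ) - D.center w| →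
      D.radius w + δ < |(y : ℝ) - D.center w| := by
    refine (eventually_all_finite (List.finite_toSet L)).2 fun w _ => ?_
    by_cases hw : D.radius w < |(y : ℝ) - D.center w|
    · filter_upwards [Ioo_mem_nhdsGT (sub_pos.2 hw)] with δ hδ _
      linarith [hδ.2]
    · exact Eventually.of_forall fun _ h => absurd h hw
  obtain ⟨δ, hδ, hpos⟩ := (hev.and self_mem_nhdsWithin).exists
  have hpos' : (0 : ℝ) < δ := hpos
  obtain ⟨c, hc⟩ := unitIntervalSpace.dense.exists_dist_lt y (half_pos hpos')
  obtain ⟨r, hr1, hr2⟩ := exists_rat_btwn hc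
  obtain ⟨k, rfl⟩ := ratEnum_surjective r
  have hdist : dist (α := unitIntervalSpace.carrier) y (unitIntervalSpace.seq c) =
    |(y : ℝ) - unitSeq c| := rfl
  rw [hdist] at hr1
  refine ⟨Nat.pair c k, ?_, fun w hw hlt => ?_⟩
  · change |(y : ℝ) - unitSeq (Nat.pair c k).unpair.1| < (ratEnum (Nat.pair c k).unpair.2 : ℝ)
    rwa [Nat.unpair_pair]
  · rw [formalOut_iff, Nat.unpair_pair]
    have h1 := hδ w hw hlt
    have h2 := abs_sub_le (y : ℝ) (unitSeq c) (D.center w)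
    rw [abs_sub_comm (unitSeq c : ℝ) (D.center w)] at h2
    change _ ≤ |D.center w - unitSeq c|
    linarith

/-- A ball is seen to be disjoint from the image of a compact set of binary sequences, by means of
the prefix `s` of an interleaved name of the compact set: it is formally disjoint from all cells of
a level whose cylinders are not seen to be in the complement of the compact set. -/
def SeenOutside (n : ℕ) (s : List ℕ) : Prop :=
  ∀ w ∈ binaryWords n.unpair.2,
    unitExactDist.FormalOut (D.centerIndex w) (D.radiusIndex w) n.unpair.1 ∨
    ∃ i < n, baireExactDist.FormalIn (Encodable.encode w) (wordRadius w) (s.getD (2 * i + 1) 0)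

open Classical in
/-- The ball that is removed from the image of a compact set of binary sequences. -/
noncomputable def imageStep (n : ℕ) (s : List ℕ) : ℕ :=
  if D.SeenOutside n s then n.unpair.1 else 0

theorem primrec_imageStep : Primrec₂ D.imageStep := by
  classical
  have hn : Primrec fun t : List ℕ × ℕ × List ℕ => t.2.1 := Primrec.fst.comp Primrec.snd
  have hout : PrimrecPred fun t : List ℕ × ℕ × List ℕ =>
      unitExactDist.FormalOut (D.centerIndex t.1) (D.radiusIndex t.1) t.2.1.unpair.1 :=
    unitExactDist.primrecPred_formalOut (D.primrec_centerIndex.comp Primrec.fst)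
      (D.primrec_radiusIndex.comp Primrec.fst) (Primrec.fst.comp (Primrec.unpair.comp hn))
  have hin : PrimrecRel fun (i : ℕ) (t : List ℕ × ℕ × List ℕ) => baireExactDist.FormalIn
      (Encodable.encode t.1) (wordRadius t.1) (t.2.2.getD (2 * i + 1) 0) := by
    have hw : Primrec fun t : ℕ × List ℕ × ℕ × List ℕ => t.2.1 := Primrec.fst.comp Primrec.snd
    have hs : Primrec fun t : ℕ × List ℕ × ℕ × List ℕ => t.2.2.2 :=
      Primrec.snd.comp (Primrec.snd.comp Primrec.snd)
    have hi : Primrec fun t : ℕ × List ℕ × ℕ × List ℕ => 2 * t.1 + 1 :=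
      Primrec.succ.comp (Primrec.nat_mul.comp (Primrec.const 2) Primrec.fst)
    exact baireExactDist.primrecPred_formalIn (Primrec.encode.comp hw)
      (primrec_wordRadius.comp hw) ((Primrec.list_getD 0).comp hs hi)
  have hin' : PrimrecPred fun t : List ℕ × ℕ × List ℕ => ∃ i < t.2.1, baireExactDist.FormalIn
      (Encodable.encode t.1) (wordRadius t.1) (t.2.2.getD (2 * i + 1) 0) := by
    refine (hin.exists_mem_list.comp (Primrec.list_range.comp hn) Primrec.id).of_eq fun t => ?_
    simp only [List.mem_range, id]
  have hrel : PrimrecRel fun (w : List ℕ) (t : ℕ × List ℕ) =>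
      unitExactDist.FormalOut (D.centerIndex w) (D.radiusIndex w) t.1.unpair.1 ∨
      ∃ i < t.1, baireExactDist.FormalIn (Encodable.encode w) (wordRadius w)
        (t.2.getD (2 * i + 1) 0) := hout.or hin'
  have hall : PrimrecPred fun t : ℕ × List ℕ => D.SeenOutside t.1 t.2 := by
    have := hrel.forall_mem_list.comp (primrec_binaryWords.comp
      (Primrec.snd.comp (Primrec.unpair.comp Primrec.fst))) Primrec.id
    exact this
  exact Primrec.ite hall (Primrec.fst.comp (Primrec.unpair.comp Primrec.fst)) (Primrec.const 0)

theorem interleave_odd (p q : ℕ → ℕ) (i : ℕ) : interleave p q (2 * i + 1) = q i := by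
  rw [interleave, if_neg (by omega)]
  congr 1
  omega

/-- Images of closed sets of binary sequences under the point map are computable. -/
theorem exists_image : ∃ Ψ : (ℕ → ℕ) →. (ℕ → ℕ), Type2Computable Ψ ∧ ∀ p q,
    ∃ r ∈ Ψ (interleave p q),
      (unitIntervalSpace.closedOfName r : Set unitIntervalSpace.carrier) =
        D.point '' (binarySeqs ∩ (baireSpace.closedOfName q : Set baireSpace.carrier)) := by
  refine ⟨_, type2Computable_of_prefix D.primrec_imageStep, fun p q =>
    ⟨_, Part.mem_some _, ?_⟩⟩
  have hget : ∀ n, ∀ i < n, (initSeg (interleave p q) (2 * n + 2)).getD (2 * i + 1) 0 = q i :=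
    fun n i hi => by rw [initSeg_getD _ (by omega), interleave_odd]
  refine Set.ext fun (y : Icc (0 : ℝ) 1) => Iff.trans mem_closedOfName ?_
  constructor
  · intro hy
    by_contra hcon
    obtain ⟨m, hm⟩ := D.exists_cover_of_forall_val_ne (q := q) (y := y)
      fun x hx hq hxy => hcon ⟨x, ⟨hx, hq⟩, Subtype.ext hxy⟩
    obtain ⟨j, hj, hout⟩ := D.exists_formalOut y (binaryWords m)
    -- The output index codes both the ball `j` and the level `m`. As `m ≤ Nat.pair j m`, the
    -- entries needed at level `m` have been read.
    apply hy (Nat.pair j m)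
    rw [imageStep, if_pos]
    · rwa [Nat.unpair_pair]
    · intro w hw
      rw [Nat.unpair_pair] at hw ⊢
      refine (hm w hw).imp (hout w hw) ?_
      rintro ⟨i, hi, hin⟩
      have hi' : i < Nat.pair j m := hi.trans_le (Nat.right_le_pair j m)
      exact ⟨i, hi', by rwa [hget _ i hi']⟩
  -- The prefix of `x` at the tested level refutes a false removal: its cell contains the point and
  -- its cylinder contains `x`, so neither alternative can hold.
  · rintro ⟨x, ⟨hx, hq⟩, rfl⟩ n hn
    rw [imageStep] at hn
    split_ifs at hn with hall
    · have hw : initSeg x n.unpair.2 ∈ binaryWords n.unpair.2 := by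
        refine mem_binaryWords.2 ⟨initSeg_length _ _, fun d hd => ?_⟩
        obtain ⟨i, -, rfl⟩ := List.mem_map.1 hd
        exact hx i
      rcases hall _ hw with hout | ⟨i, hi, hin⟩
      · rw [formalOut_iff] at hout
        change |D.val x - unitSeq _| < _ at hn
        have h1 := D.abs_val_sub_center_le x n.unpair.2
        have h2 := abs_sub_le (D.center (initSeg x n.unpair.2)) (D.val x)
          (unitSeq n.unpair.1.unpair.1)
        rw [abs_sub_comm (D.center _) (D.val x)] at h2
        linarith
      · rw [hget n i hi] at hin
        exact mem_closedOfName.1 hq i (mem_of_formalIn_word (by rw [initSeg_length]) hin)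
    · rw [basicBall_zero] at hn
      exact hn

end DigitSystem

/-! ### The two reductions -/

open DigitSystem

theorem primrecPred_false {α : Type*} [Primcodable α] : PrimrecPred fun _ : α => False :=
  ⟨fun _ => instDecidableFalse, Primrec.const false⟩

/-! ### Perfectness and uncountability under the point maps -/

theorem perfect_image_binary {C : Set (ℕ → ℕ)} (hC : Perfect C) (hsub : C ⊆ binarySeqs) :
    Perfect (binary.point '' C) := by
  refine ⟨((isCompact_binarySeqs.of_isClosed_subset hC.closed hsub).image
    binary.continuous_point).isClosed, preperfect_iff_nhds.2 ?_⟩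
  rintro _ ⟨x, hx, rfl⟩ U hU
  have hV := binary.continuous_point.continuousAt.preimage_mem_nhds hU
  let _ := PiNat.metricSpaceNatNat
  -- Uncountably many points of `C` are mapped into `U`. One that differs from `x` and is not
  -- eventually constant cannot share its value with `x`.
  obtain ⟨z, ⟨hzU, hzC⟩, hz⟩ := exists_mem_notMem_of_not_countable
    (hC.not_countable_inter hx hV) (countable_eventuallyConst.insert x)
  rw [mem_insert_iff, not_or] at hz
  refine ⟨binary.point z, ⟨hzU, z, hzC, rfl⟩, fun h => hz.2 ?_⟩
  exact mem_eventuallyConst_of_binary_val_eq (hsub hzC) (hsub hx) hz.1 (congrArg Subtype.val h)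

theorem exists_alternating_point {C : Set (Icc (0 : ℝ) 1)} (hC : ¬ C.Countable)
    {E : Set (ℕ → ℕ)} (hE : E.Countable) : ∃ x, alternating.point x ∈ C ∧ x ∉ E := by
  obtain ⟨y, hy, hyE⟩ := exists_mem_notMem_of_not_countable hC
    ((countable_alternatingEndpoints.preimage Subtype.val_injective).union
      (hE.image alternating.point))
  rw [mem_union, not_or] at hyE
  obtain ⟨x, hx⟩ := exists_alternating_val_eq y.2 hyE.1
  have hxy : alternating.point x = y := Subtype.ext hx
  exact ⟨x, hxy ▸ hy, fun hxE => hyE.2 ⟨x, hxE, hxy⟩⟩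

theorem perfect_preimage_alternating {C : Set (Icc (0 : ℝ) 1)} (hC : Perfect C) :
    Perfect (alternating.point ⁻¹' C) := by
  refine ⟨hC.closed.preimage alternating.continuous_point, preperfect_iff_nhds.2 ?_⟩
  intro x hx U hU
  obtain ⟨n, hn⟩ := exists_initSeg_subset_of_mem_nhds hU
  -- The cylinder around `x` is the trace of an open cell, which meets `C` in an uncountable set;
  -- hence it contains a point of `C` with an expansion other than `x`.
  have hopen : {y : Icc (0 : ℝ) 1 | |(y : ℝ) - alternating.center (initSeg x n)| <
      alternating.radius (initSeg x n)} ∈ 𝓝 (alternating.point x) := by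
    refine IsOpen.mem_nhds (isOpen_lt (by fun_prop) continuous_const) ?_
    exact alternating_abs_lt_iff.2 (by rw [initSeg_length])
  obtain ⟨z, ⟨hzn, hzC⟩, hzx⟩ := exists_alternating_point (hC.not_countable_inter hx hopen)
    (countable_singleton x)
  refine ⟨z, ⟨hn z ?_, hzC⟩, hzx⟩
  have := alternating_abs_lt_iff.1 hzn
  rwa [initSeg_length] at this

theorem not_countable_preimage_binary {C : Set (Icc (0 : ℝ) 1)} (hC : ¬ C.Countable) :
    ¬ {x | x ∈ binarySeqs ∧ binary.point x ∈ C}.Countable := by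
  refine fun h => hC ((h.image binary.point).mono fun y hy => ?_)
  obtain ⟨x, hx, hxy⟩ := exists_binary_val_eq y.2
  have hxy' : binary.point x = y := Subtype.ext hxy
  exact ⟨x, ⟨hx, hxy' ▸ hy⟩, hxy'⟩

theorem PST_unitInterval_le_PST_baire :
    WeihrauchLE (PST unitIntervalSpace) (PST baireSpace) := by
  have hexcl : PrimrecPred fun σ : List ℕ => ∃ d ∈ σ, ¬ d < 2 :=
    (Primrec.nat_lt.comp Primrec.id (Primrec.const 2)).not.exists_mem_list
  obtain ⟨Φ, hΦ, hΦspec⟩ := binary.exists_preimage hexcl (pos := id) Primrec.id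
    (fun i => by rw [id]; omega)
  obtain ⟨Ψ, hΨ, hΨspec⟩ := binary.exists_image
  refine ⟨Φ, Ψ, hΦ, hΨ, fun p A hp hA => ?_⟩
  obtain rfl := Part.mem_some_iff.1 hp
  obtain ⟨p', hp', hmem⟩ := hΦspec p
  have hset : (baireSpace.closedOfName p' : Set baireSpace.carrier) = {x : ℕ → ℕ |
      x ∈ binarySeqs ∧ binary.point x ∈
        (unitIntervalSpace.closedOfName p : Set unitIntervalSpace.carrier)} := by
    refine Set.ext fun (x : ℕ → ℕ) => (hmem x).trans (and_congr ?_ Iff.rfl)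
    constructor
    · intro h i
      by_contra hi
      -- Length `i + 1` makes the prefix long enough to contain the digit `x i`.
      exact h (i + 1) ⟨x i, List.mem_map.2 ⟨i, by simp, rfl⟩, hi⟩
    · rintro h n ⟨d, hd, hd2⟩
      obtain ⟨i, -, rfl⟩ := List.mem_map.1 hd
      exact hd2 (h i)
  refine ⟨p', hp', baireSpace.closedOfName p', Part.mem_some _, ?_, ?_⟩
  · change ¬ (baireSpace.closedOfName p' : Set baireSpace.carrier).Countable
    rw [hset]
    exact not_countable_preimage_binary hA
  · rintro q P hq ⟨hPA, hP, hPne⟩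
    obtain rfl := Part.mem_some_iff.1 hq
    obtain ⟨r, hr, himage⟩ := hΨspec p q
    rw [hset] at hPA
    have hbin : (baireSpace.closedOfName q : Set baireSpace.carrier) ⊆ binarySeqs := fun x hx => (hPA hx).1
    replace himage : (unitIntervalSpace.closedOfName r : Set unitIntervalSpace.carrier) =
        binary.point '' (baireSpace.closedOfName q : Set baireSpace.carrier) :=
      himage.trans (congrArg _ (inter_eq_self_of_subset_right hbin))
    refine ⟨r, hr, unitIntervalSpace.closedOfName r, Part.mem_some _, ?_, ?_, ?_⟩
    · rw [himage]
      rintro _ ⟨x, hx, rfl⟩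
      exact (hPA hx).2
    · rw [himage]
      exact perfect_image_binary hP hbin
    · rw [himage]
      exact hPne.image _

/-- The cylinders of words together with the open cells of their alternating expansions. -/
noncomputable def cellTransfer : CellTransfer baireSpace unitIntervalSpace where
  center := Encodable.encode
  radius := wordRadius
  image σ := Nat.pair (alternating.centerIndex σ) (alternating.radiusIndex σ)
  excluded _ := False
  primrec_center := Primrec.encode
  primrec_radius := primrec_wordRadius
  primrec_image := Primrec₂.natPair.comp alternating.primrec_centerIndex
    alternating.primrec_radiusIndex
  primrec_excluded := primrecPred_false

theorem mem_basicBall_cell {x : ℕ → ℕ} {σ : List ℕ} :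
    alternating.point x ∈ unitIntervalSpace.basicBall (cellTransfer.image σ) ↔
      initSeg x σ.length = σ := by
  rw [← alternating_abs_lt_iff, ← unitSeq_centerIndex, ← ratEnum_radiusIndex]
  simp only [ComputablePolishSpace.basicBall, cellTransfer, Nat.unpair_pair]
  rfl

theorem PST_baire_le_PST_unitInterval :
    WeihrauchLE (PST baireSpace) (PST unitIntervalSpace) := by
  obtain ⟨Φ, hΦ, hΦspec⟩ := cellTransfer.exists_type2Computable baireExactDist (pos := id)
    Primrec.id (fun i => by rw [id]; omega)
  -- The odd positions of the interleaved name carry the perfect set; the original name is not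
  -- consulted.
  obtain ⟨Ψ, hΨ, hΨspec⟩ := alternating.exists_preimage (primrecPred_false)
    (pos := fun i => 2 * i + 1)
    (Primrec.succ.comp (Primrec.nat_mul.comp (Primrec.const 2) Primrec.id)) (fun _ => le_rfl)
  refine ⟨Φ, Ψ, hΦ, hΨ, fun p A hp hA => ?_⟩
  obtain rfl := Part.mem_some_iff.1 hp
  obtain ⟨p', hp', hmem⟩ := hΦspec p
  -- The output is determined only on points with an infinite expansion. This suffices: injectivity
  -- gives uncountability, and solutions are pulled back to Baire space.
  have hset : ∀ x : ℕ → ℕ, alternating.point x ∈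
      (unitIntervalSpace.closedOfName p' : Set unitIntervalSpace.carrier) ↔
      x ∈ (baireSpace.closedOfName p : Set baireSpace.carrier) := by
    intro x
    refine (hmem _).trans (Iff.trans ?_ mem_closedOfName.symm)
    constructor
    · intro h i hi
      obtain ⟨N, hN⟩ := exists_formalIn_word hi
      exact (h (initSeg x N) (mem_basicBall_cell.2 (by rw [initSeg_length]))).2 i (hN N le_rfl)
    · intro h σ hσ
      exact ⟨id, fun i hi => h i (mem_of_formalIn_word (mem_basicBall_cell.1 hσ) hi)⟩
  refine ⟨p', hp', unitIntervalSpace.closedOfName p', Part.mem_some _, ?_, ?_⟩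
  · intro hcount
    have hinj : Function.Injective alternating.point := fun x z h =>
      alternating_val_injective (congrArg Subtype.val h)
    have hpre : (alternating.point ⁻¹' (unitIntervalSpace.closedOfName p' :
      Set unitIntervalSpace.carrier)).Countable := Set.Countable.preimage hcount hinj
    exact hA (hpre.mono fun x hx => (hset x).2 hx)
  · rintro q P hq ⟨hPA, hP, hPne⟩
    obtain rfl := Part.mem_some_iff.1 hq
    obtain ⟨r, hr, hmemr⟩ := hΨspec (interleave p q)
    simp only [interleave_odd] at hmemr
    have hpre : (baireSpace.closedOfName r : Set baireSpace.carrier) = alternating.point ⁻¹'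
        (unitIntervalSpace.closedOfName q : Set unitIntervalSpace.carrier) :=
      Set.ext fun x => (hmemr x).trans (and_iff_right fun _ => id)
    refine ⟨r, hr, baireSpace.closedOfName r, Part.mem_some _, ?_, ?_, ?_⟩
    · rw [hpre]
      exact fun x hx => (hset x).1 (hPA hx)
    · rw [hpre]
      exact perfect_preimage_alternating hP
    · rw [hpre]
      -- A nonempty perfect set is uncountable, so it cannot consist of endpoints alone.
      obtain ⟨x, hx, -⟩ := exists_alternating_point (hP.not_countable hPne) countable_empty
      exact ⟨x, hx⟩

theorem mainTheorem9 : WeihrauchEquiv (PST unitIntervalSpace) (PST baireSpace) :=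
  ⟨PST_unitInterval_le_PST_baire, PST_baire_le_PST_unitInterval⟩
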